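/- Let $\mathbb K=\mathbb R$ or $\mathbb C$, let $V=V_0\oplus V_1$ be a super vector space over $\mathbb K$ with a homogeneous basis $(x^i)_{i\in I}$, and let $\widetilde V=V\oplus\mathbb K^{0|1}$, with $x^0$ a basis of the additional odd line. Write $y_i\in V^*$ for the coordinate functionals of the basis $(x^i)$ and let the index $a$ run over $I\cup\{0\}$. Let $\mathbb K[[\widetilde V,\hbar]]$ be the completion of the superalgebra of polynomials in the (super)commuting variables $x^a$ and $\hbar$ with respect to the grading $\deg x^a=1$, $\deg\hbar=2$, so that its elements are formal sums $\sum_{d\ge 0}f_d$ of homogeneous polynomials $f_d$ of degree $d$. Let $\widehat{\mathcal W_\hbar}(\widetilde V)$ be the completed Weyl algebra: the closure, for pointwise convergence of operators on $\mathbb K[[\widetilde V,\hbar]]$, of the algebra generated by $\hbar$, $x^a$ and $\hbar\partial_a$ (with $\partial_a$ the left derivative). It is graded by $\deg x^a=\deg\hbar\partial_a=1$, $\deg\hbar=2$; superscripts $\le n$, $\ge n$ refer to this degree. A super quantum Airy structure $(V,L)$ is given by an even linear map $L:V^*\to\widehat{\mathcal W_\hbar}(\widetilde V)$, continuous for the topologies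 of pointwise convergence on $V^*$ (with $\mathbb K$ discrete) and on $\widehat{\mathcal W_\hbar}(\widetilde V)$, such that 1. the left ideal $\mathfrak L\subseteq\widehat{\mathcal W_\hbar}(\widetilde V)$ generated by $L(V^*)$ satisfies $[\mathfrak L,\mathfrak L]\subseteq\hbar\,\mathfrak L$, where $[D,E]=DE-(-1)^{|D||E|}ED$ is the supercommutator; 2. $L(y_i)^{\le 1}=\hbar\partial_i$ for all $i\in I$. For an even series $F\in\mathbb K[[\widetilde V,\hbar]]$ all of whose terms have degree at least $3$, and $D\in\widehat{\mathcal W_\hbar}(\widetilde V)$, put $$\psi_F(D)=\sum_{n\ge 0}\frac1{n!}\Bigl(-\frac1\hbar[F,\,\cdot\,]\Bigr)^n(D).$$ **Theorem.** For every super quantum Airy structure $(V,L)$ there is exactly one series $F\in\mathbb K[[\widetilde V,\hbar]]$ (the free energy) such that $F$ is even, all terms of $F$ have degree at least $3$, $F$ has no term independent of the variables $x^a$, and $\psi_F(L(\phi))\cdot 1=0$ for all $\phi\in V^*$. -/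

import Mathlib

open scoped TensorProduct

noncomputable section

namespace SuperAiry

section Polynomials

variable (𝕜 : Type*) [Field 𝕜] (I₀ I₁ : Type*)

/-- The superalgebra `𝕜[Ṽ, ħ]` of polynomials in `ħ`, in the even variables `xⁱ` (`i : I₀`) and in
the odd variables (`Option I₁`, where `none` is the extra fermionic variable `x⁰`): polynomials
in `ħ` (the index `none : Option I₀`) and the even variables, tensored with the exterior
(Grassmann) algebra on the odd variables. -/
def Poly : Type _ :=
  MvPolynomial (Option I₀) 𝕜 ⊗[𝕜] ExteriorAlgebra 𝕜 (Option I₁ →₀ 𝕜)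

instance : Ring (Poly 𝕜 I₀ I₁) :=
  inferInstanceAs (Ring (MvPolynomial (Option I₀) 𝕜 ⊗[𝕜] ExteriorAlgebra 𝕜 (Option I₁ →₀ 𝕜)))

instance : Algebra 𝕜 (Poly 𝕜 I₀ I₁) :=
  inferInstanceAs (Algebra 𝕜 (MvPolynomial (Option I₀) 𝕜 ⊗[𝕜] ExteriorAlgebra 𝕜 (Option I₁ →₀ 𝕜)))

/-- The product of a polynomial in `ħ` and the even variables and a Grassmann polynomial. -/
def tm (p : MvPolynomial (Option I₀) 𝕜) (w : ExteriorAlgebra 𝕜 (Option I₁ →₀ 𝕜)) :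
    Poly 𝕜 I₀ I₁ := p ⊗ₜ[𝕜] w

/-- The variable `ħ`. -/
def hbar : Poly 𝕜 I₀ I₁ := tm 𝕜 I₀ I₁ (MvPolynomial.X none) 1

/-- The variable `xᵃ`, where `a : I₀ ⊕ Option I₁` indexes the basis of `Ṽ`. -/
def gen : I₀ ⊕ Option I₁ → Poly 𝕜 I₀ I₁
  | Sum.inl i => tm 𝕜 I₀ I₁ (MvPolynomial.X (some i)) 1
  | Sum.inr j => tm 𝕜 I₀ I₁ 1 (ExteriorAlgebra.ι 𝕜 (Finsupp.single j 1))

/-- Contraction with the `j`-th dual basis vector: the left derivative `∂ⱼ` on Grassmann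
polynomials, `∂ⱼ(θₖ u) = δⱼₖ u - θₖ ∂ⱼ u`. -/
def oddPd (j : Option I₁) :
    ExteriorAlgebra 𝕜 (Option I₁ →₀ 𝕜) →ₗ[𝕜] ExteriorAlgebra 𝕜 (Option I₁ →₀ 𝕜) :=
  CliffordAlgebra.contractLeft (Q := (0 : QuadraticForm 𝕜 (Option I₁ →₀ 𝕜))) (Finsupp.lapply j)

/-- The (left) partial derivative `∂ₐ` on polynomials. -/
def pd : I₀ ⊕ Option I₁ → Poly 𝕜 I₀ I₁ →ₗ[𝕜] Poly 𝕜 I₀ I₁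
  | Sum.inl i => TensorProduct.map (MvPolynomial.pderiv (R := 𝕜) (some i)).toLinearMap
      LinearMap.id
  | Sum.inr j => TensorProduct.map LinearMap.id (oddPd 𝕜 I₁ j)

/-- Division by `ħ`: `ħᵏ⁺¹ u ↦ ħᵏ u`, and `u ↦ 0` for `u` free of `ħ`. -/
def divHbar : Poly 𝕜 I₀ I₁ →ₗ[𝕜] Poly 𝕜 I₀ I₁ :=
  TensorProduct.map
    { toFun := fun p => MvPolynomial.divMonomial p (Finsupp.single none 1)
      map_add' := fun p q => MvPolynomial.add_divMonomial p q _
      map_smul' := fun c p => by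
        ext m
        simp [MvPolynomial.coeff_divMonomial] }
    LinearMap.id

/-- The parity involution: identity on even polynomials and `-1` on odd ones. -/
def parityInv : Poly 𝕜 I₀ I₁ →ₐ[𝕜] Poly 𝕜 I₀ I₁ :=
  Algebra.TensorProduct.map (AlgHom.id 𝕜 (MvPolynomial (Option I₀) 𝕜))
    (CliffordAlgebra.involute (Q := (0 : QuadraticForm 𝕜 (Option I₁ →₀ 𝕜))))

/-- Polynomials homogeneous of degree `d`, where `deg xᵃ = 1` and `deg ħ = 2`. -/
def homog (d : ℕ) : Submodule 𝕜 (Poly 𝕜 I₀ I₁) :=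
  Submodule.span 𝕜 {u | ∃ (k : ℕ) (l : List (I₀ ⊕ Option I₁)), 2 * k + l.length = d ∧
    u = hbar 𝕜 I₀ I₁ ^ k * (l.map (gen 𝕜 I₀ I₁)).prod}

variable {𝕜 I₀ I₁}

@[elab_as_elim]
theorem poly_induction {P : Poly 𝕜 I₀ I₁ → Prop} (u : Poly 𝕜 I₀ I₁) (zero : P 0)
    (tmul : ∀ p w, P (tm 𝕜 I₀ I₁ p w)) (add : ∀ u v, P u → P v → P (u + v)) : P u :=
  TensorProduct.induction_on u zero tmul add

theorem tm_mul (p q : MvPolynomial (Option I₀) 𝕜)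
    (v w : ExteriorAlgebra 𝕜 (Option I₁ →₀ 𝕜)) :
    tm 𝕜 I₀ I₁ p v * tm 𝕜 I₀ I₁ q w = tm 𝕜 I₀ I₁ (p * q) (v * w) :=
  Algebra.TensorProduct.tmul_mul_tmul _ _ _ _

theorem one_eq_tm : (1 : Poly 𝕜 I₀ I₁) = tm 𝕜 I₀ I₁ 1 1 := rfl

theorem tm_add_left (p q : MvPolynomial (Option I₀) 𝕜)
    (w : ExteriorAlgebra 𝕜 (Option I₁ →₀ 𝕜)) :
    tm 𝕜 I₀ I₁ (p + q) w = tm 𝕜 I₀ I₁ p w + tm 𝕜 I₀ I₁ q w := TensorProduct.add_tmul _ _ _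

theorem tm_zero_left (w : ExteriorAlgebra 𝕜 (Option I₁ →₀ 𝕜)) : tm 𝕜 I₀ I₁ 0 w = 0 :=
  TensorProduct.zero_tmul _ _

theorem tm_zero_right (p : MvPolynomial (Option I₀) 𝕜) : tm 𝕜 I₀ I₁ p 0 = 0 :=
  TensorProduct.tmul_zero _ _

theorem tm_add_right (p : MvPolynomial (Option I₀) 𝕜)
    (v w : ExteriorAlgebra 𝕜 (Option I₁ →₀ 𝕜)) :
    tm 𝕜 I₀ I₁ p (v + w) = tm 𝕜 I₀ I₁ p v + tm 𝕜 I₀ I₁ p w := TensorProduct.tmul_add _ _ _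

theorem tm_smul_right (c : 𝕜) (p : MvPolynomial (Option I₀) 𝕜)
    (w : ExteriorAlgebra 𝕜 (Option I₁ →₀ 𝕜)) :
    tm 𝕜 I₀ I₁ p (c • w) = c • tm 𝕜 I₀ I₁ p w := TensorProduct.tmul_smul _ _ _

theorem pd_inl_tm (i : I₀) (p : MvPolynomial (Option I₀) 𝕜)
    (w : ExteriorAlgebra 𝕜 (Option I₁ →₀ 𝕜)) :
    pd 𝕜 I₀ I₁ (Sum.inl i) (tm 𝕜 I₀ I₁ p w) =
      tm 𝕜 I₀ I₁ (MvPolynomial.pderiv (some i) p) w := rfl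

theorem pd_inr_tm (j : Option I₁) (p : MvPolynomial (Option I₀) 𝕜)
    (w : ExteriorAlgebra 𝕜 (Option I₁ →₀ 𝕜)) :
    pd 𝕜 I₀ I₁ (Sum.inr j) (tm 𝕜 I₀ I₁ p w) = tm 𝕜 I₀ I₁ p (oddPd 𝕜 I₁ j w) := rfl

theorem oddPd_ι_mul (j k : Option I₁) (w : ExteriorAlgebra 𝕜 (Option I₁ →₀ 𝕜)) :
    oddPd 𝕜 I₁ j (ExteriorAlgebra.ι 𝕜 (Finsupp.single k 1) * w) =
      Finsupp.single k (1 : 𝕜) j • w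
        - ExteriorAlgebra.ι 𝕜 (Finsupp.single k 1) * oddPd 𝕜 I₁ j w :=
  CliffordAlgebra.contractLeft_ι_mul _ _ _

theorem oddPd_one (j : Option I₁) : oddPd 𝕜 I₁ j 1 = 0 :=
  CliffordAlgebra.contractLeft_one (Q := (0 : QuadraticForm 𝕜 (Option I₁ →₀ 𝕜))) _

theorem divHbar_tm (p : MvPolynomial (Option I₀) 𝕜)
    (w : ExteriorAlgebra 𝕜 (Option I₁ →₀ 𝕜)) :
    divHbar 𝕜 I₀ I₁ (tm 𝕜 I₀ I₁ p w) =
      tm 𝕜 I₀ I₁ (MvPolynomial.divMonomial p (Finsupp.single none 1)) w := rfl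

theorem parityInv_tm (p : MvPolynomial (Option I₀) 𝕜)
    (w : ExteriorAlgebra 𝕜 (Option I₁ →₀ 𝕜)) :
    parityInv 𝕜 I₀ I₁ (tm 𝕜 I₀ I₁ p w) = tm 𝕜 I₀ I₁ p (CliffordAlgebra.involute w) := rfl

theorem hbar_commute (u : Poly 𝕜 I₀ I₁) : Commute (hbar 𝕜 I₀ I₁) u := by
  unfold hbar
  induction u using poly_induction with
  | zero => exact Commute.zero_right _
  | tmul p w => simp [Commute, SemiconjBy, mul_comm, tm_mul]
  | add u v hu hv => exact hu.add_right hv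

theorem mem_homog (k : ℕ) (l : List (I₀ ⊕ Option I₁)) :
    hbar 𝕜 I₀ I₁ ^ k * (l.map (gen 𝕜 I₀ I₁)).prod ∈ homog 𝕜 I₀ I₁ (2 * k + l.length) :=
  Submodule.subset_span ⟨k, l, rfl, rfl⟩

theorem homog_mul {p q : ℕ} {u v : Poly 𝕜 I₀ I₁} (hu : u ∈ homog 𝕜 I₀ I₁ p)
    (hv : v ∈ homog 𝕜 I₀ I₁ q) : u * v ∈ homog 𝕜 I₀ I₁ (p + q) := by
  have h := Submodule.mul_mem_mul hu hv
  rw [homog, homog, Submodule.span_mul_span] at h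
  refine Submodule.span_mono ?_ h
  rintro _ ⟨_, ⟨k, l, rfl, rfl⟩, _, ⟨k', l', rfl, rfl⟩, rfl⟩
  refine ⟨k + k', l ++ l', by simp; ring, ?_⟩
  have hc : (l.map (gen 𝕜 I₀ I₁)).prod * hbar 𝕜 I₀ I₁ ^ k' =
      hbar 𝕜 I₀ I₁ ^ k' * (l.map (gen 𝕜 I₀ I₁)).prod :=
    ((hbar_commute _).pow_left k').eq.symm
  simp only [List.map_append, List.prod_append, pow_add]
  rw [mul_assoc, ← mul_assoc _ (hbar 𝕜 I₀ I₁ ^ k'), hc]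
  simp only [mul_assoc]

theorem one_mem_homog : (1 : Poly 𝕜 I₀ I₁) ∈ homog 𝕜 I₀ I₁ 0 := by
  simpa using mem_homog (𝕜 := 𝕜) (I₀ := I₀) (I₁ := I₁) 0 []

theorem hbar_mem_homog : hbar 𝕜 I₀ I₁ ∈ homog 𝕜 I₀ I₁ 2 := by
  simpa using mem_homog (𝕜 := 𝕜) (I₀ := I₀) (I₁ := I₁) 1 []

theorem gen_mem_homog (a : I₀ ⊕ Option I₁) : gen 𝕜 I₀ I₁ a ∈ homog 𝕜 I₀ I₁ 1 := by
  simpa using mem_homog (𝕜 := 𝕜) (I₀ := I₀) (I₁ := I₁) 0 [a]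

theorem pd_hbar_mul (a : I₀ ⊕ Option I₁) (u : Poly 𝕜 I₀ I₁) :
    pd 𝕜 I₀ I₁ a (hbar 𝕜 I₀ I₁ * u) = hbar 𝕜 I₀ I₁ * pd 𝕜 I₀ I₁ a u := by
  induction u using poly_induction with
  | zero => simp
  | tmul p w => cases a <;> simp [hbar, tm_mul, pd_inl_tm, pd_inr_tm]
  | add u v hu hv => simp only [mul_add, map_add, hu, hv]

theorem pd_one (a : I₀ ⊕ Option I₁) : pd 𝕜 I₀ I₁ a 1 = 0 := by
  rw [one_eq_tm]
  cases a <;> simp [pd_inl_tm, pd_inr_tm, oddPd_one, tm_zero_left, tm_zero_right]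

/-- The super Leibniz rule for a generator. -/
theorem pd_gen_mul (a b : I₀ ⊕ Option I₁) :
    ∃ c e : 𝕜, ∀ u : Poly 𝕜 I₀ I₁,
      pd 𝕜 I₀ I₁ a (gen 𝕜 I₀ I₁ b * u) = c • u + e • (gen 𝕜 I₀ I₁ b * pd 𝕜 I₀ I₁ a u) := by
  classical
  have red : ∀ c e : 𝕜, (∀ p w, pd 𝕜 I₀ I₁ a (gen 𝕜 I₀ I₁ b * tm 𝕜 I₀ I₁ p w) =
      c • tm 𝕜 I₀ I₁ p w + e • (gen 𝕜 I₀ I₁ b * pd 𝕜 I₀ I₁ a (tm 𝕜 I₀ I₁ p w))) →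
      ∀ u : Poly 𝕜 I₀ I₁, pd 𝕜 I₀ I₁ a (gen 𝕜 I₀ I₁ b * u) =
        c • u + e • (gen 𝕜 I₀ I₁ b * pd 𝕜 I₀ I₁ a u) := by
    intro c e h u
    induction u using poly_induction with
    | zero => simp
    | tmul p w => exact h p w
    | add u v hu hv => simp only [mul_add, map_add, hu, hv, smul_add]; abel
  rcases a with i | j <;> rcases b with i' | j'
  · refine ⟨if i = i' then 1 else 0, 1, red _ _ fun p w => ?_⟩
    by_cases h : i = i'
    · subst h
      simp [gen, tm_mul, pd_inl_tm, tm_add_left, add_comm]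
    · simp [gen, tm_mul, pd_inl_tm, MvPolynomial.pderiv_X, h, eq_comm]
  · refine ⟨0, 1, red _ _ fun p w => ?_⟩
    simp [gen, tm_mul, pd_inl_tm]
  · refine ⟨0, 1, red _ _ fun p w => ?_⟩
    simp [gen, tm_mul, pd_inr_tm]
  · refine ⟨Finsupp.single j' (1 : 𝕜) j, -1, red _ _ fun p w => ?_⟩
    have h : oddPd 𝕜 I₁ j (ExteriorAlgebra.ι 𝕜 (Finsupp.single j' 1) * w) =
        Finsupp.single j' (1 : 𝕜) j • w +
          (-1 : 𝕜) • (ExteriorAlgebra.ι 𝕜 (Finsupp.single j' 1) * oddPd 𝕜 I₁ j w) := by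
      rw [oddPd_ι_mul, neg_smul, one_smul, sub_eq_add_neg]
    simp only [gen, tm_mul, pd_inr_tm, one_mul, h, tm_add_right, tm_smul_right]

theorem pd_mem_homog (a : I₀ ⊕ Option I₁) (d : ℕ) (u : Poly 𝕜 I₀ I₁)
    (hu : u ∈ homog 𝕜 I₀ I₁ (d + 1)) : pd 𝕜 I₀ I₁ a u ∈ homog 𝕜 I₀ I₁ d := by
  have key : ∀ (l : List (I₀ ⊕ Option I₁)) (n : ℕ), l.length = n + 1 →
      pd 𝕜 I₀ I₁ a (l.map (gen 𝕜 I₀ I₁)).prod ∈ homog 𝕜 I₀ I₁ n := by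
    intro l
    induction l with
    | nil => intro n h; simp at h
    | cons b l ih =>
      intro n h
      simp only [List.length_cons, add_left_inj] at h
      obtain ⟨c, e, hce⟩ := pd_gen_mul (𝕜 := 𝕜) (I₀ := I₀) (I₁ := I₁) a b
      rw [List.map_cons, List.prod_cons, hce]
      refine add_mem (Submodule.smul_mem _ _ ?_) (Submodule.smul_mem _ _ ?_)
      · simpa [h] using mem_homog (𝕜 := 𝕜) (I₀ := I₀) (I₁ := I₁) 0 l
      · rcases n with _ | n
        · obtain rfl := List.length_eq_zero_iff.mp h
          simp [pd_one]
        · rw [add_comm n 1]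
          exact homog_mul (gen_mem_homog b) (ih n h)
  have hpow : ∀ (k : ℕ) (v : Poly 𝕜 I₀ I₁), pd 𝕜 I₀ I₁ a (hbar 𝕜 I₀ I₁ ^ k * v) =
      hbar 𝕜 I₀ I₁ ^ k * pd 𝕜 I₀ I₁ a v := by
    intro k v
    induction k with
    | zero => simp
    | succ k ih => rw [pow_succ', mul_assoc, pd_hbar_mul, ih, mul_assoc]
  have hk : ∀ k : ℕ, hbar 𝕜 I₀ I₁ ^ k ∈ homog 𝕜 I₀ I₁ (2 * k) := fun k => by
    simpa using mem_homog (𝕜 := 𝕜) (I₀ := I₀) (I₁ := I₁) k []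
  induction hu using Submodule.span_induction with
  | mem x hx =>
    obtain ⟨k, l, hd, rfl⟩ := hx
    rw [hpow]
    rcases l with _ | ⟨b, l⟩
    · simp [pd_one]
    · have h1 : d = 2 * k + l.length := by simp at hd; omega
      rw [h1]
      exact homog_mul (hk k) (key (b :: l) _ (by simp))
  | zero => simp
  | add x y _ _ hx hy => rw [map_add]; exact add_mem hx hy
  | smul c x _ hx => rw [map_smul]; exact Submodule.smul_mem _ _ hx

theorem divHbar_hbar_mul (u : Poly 𝕜 I₀ I₁) :
    divHbar 𝕜 I₀ I₁ (hbar 𝕜 I₀ I₁ * u) = u := by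
  induction u using poly_induction with
  | zero => simp
  | tmul p w => simp [divHbar_tm, hbar, tm_mul]
  | add u v hu hv => simp only [mul_add, map_add, hu, hv]

theorem divHbar_gen_prod (l : List (I₀ ⊕ Option I₁)) :
    divHbar 𝕜 I₀ I₁ (l.map (gen 𝕜 I₀ I₁)).prod = 0 := by
  have h : ∃ (p : MvPolynomial (Option I₀) 𝕜) (w : ExteriorAlgebra 𝕜 (Option I₁ →₀ 𝕜)),
      (∀ m, p.coeff (Finsupp.single none 1 + m) = 0) ∧
        (l.map (gen 𝕜 I₀ I₁)).prod = tm 𝕜 I₀ I₁ p w := by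
    classical
    induction l with
    | nil =>
      refine ⟨1, 1, fun m => ?_, rfl⟩
      rw [MvPolynomial.coeff_one, if_neg]
      intro h
      have h1 := DFunLike.congr_fun h none
      simp at h1
      omega
    | cons b l ih =>
      obtain ⟨p, w, hp, hl⟩ := ih
      rcases b with i | j
      · refine ⟨MvPolynomial.X (some i) * p, w, fun m => ?_, by simp [hl, gen, tm_mul]⟩
        rw [mul_comm, MvPolynomial.coeff_mul_X']
        split_ifs with hs
        · have hm : Finsupp.single none 1 + m - Finsupp.single (some i) 1 =
              Finsupp.single none 1 + (m - Finsupp.single (some i) 1) := by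
            ext o
            cases o <;> simp
          rw [hm, hp]
        · rfl
      · exact ⟨p, _, hp, by rw [List.map_cons, List.prod_cons, hl, gen,
          tm_mul, one_mul]⟩
  obtain ⟨p, w, hp, hl⟩ := h
  rw [hl]
  have h0 : MvPolynomial.divMonomial p (Finsupp.single none 1) = 0 := by
    ext m
    rw [MvPolynomial.coeff_divMonomial, hp, MvPolynomial.coeff_zero]
  simp [divHbar_tm, h0, tm_zero_left]

theorem divHbar_mem_homog (d : ℕ) (u : Poly 𝕜 I₀ I₁)
    (hu : u ∈ homog 𝕜 I₀ I₁ (d + 2)) : divHbar 𝕜 I₀ I₁ u ∈ homog 𝕜 I₀ I₁ d := by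
  induction hu using Submodule.span_induction with
  | mem x hx =>
    obtain ⟨k, l, hd, rfl⟩ := hx
    rcases k with _ | k
    · simp [divHbar_gen_prod]
    · rw [pow_succ', mul_assoc, divHbar_hbar_mul]
      have h1 : d = 2 * k + l.length := by omega
      rw [h1]
      exact mem_homog k l
  | zero => simp
  | add x y _ _ hx hy => rw [map_add]; exact add_mem hx hy
  | smul c x _ hx => rw [map_smul]; exact Submodule.smul_mem _ _ hx

end Polynomials

section Series

variable (𝕜 : Type*) [Field 𝕜] (I₀ I₁ : Type*)

/-- The completion `𝕜[[Ṽ, ħ]]` of `𝕜[Ṽ, ħ]`. An element is a formal sum `∑ f_d` of homogeneous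
polynomials `f_d` of degree `d = 0, 1, 2, …`, with the Cauchy product; it is encoded by the
power series `∑ f_d tᵈ`, in which `t` only records the degree. -/
def seriesSubalgebra : Subalgebra 𝕜 (PowerSeries (Poly 𝕜 I₀ I₁)) where
  carrier := {f | ∀ d, PowerSeries.coeff d f ∈ homog 𝕜 I₀ I₁ d}
  mul_mem' := by
    intro f g hf hg d
    rw [PowerSeries.coeff_mul]
    refine sum_mem fun p hp => ?_
    rw [← Finset.HasAntidiagonal.mem_antidiagonal.mp hp]
    exact homog_mul (hf _) (hg _)
  add_mem' := by
    intro f g hf hg d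
    rw [map_add]
    exact add_mem (hf d) (hg d)
  algebraMap_mem' := by
    intro r d
    rw [Algebra.algebraMap_eq_smul_one]
    have h : PowerSeries.coeff d (r • (1 : PowerSeries (Poly 𝕜 I₀ I₁))) =
        r • PowerSeries.coeff d (1 : PowerSeries (Poly 𝕜 I₀ I₁)) := rfl
    rw [h, PowerSeries.coeff_one]
    split_ifs with h0
    · subst h0
      exact Submodule.smul_mem _ _ one_mem_homog
    · simp

/-- Formal series in the `xᵃ` and `ħ`. -/
def Series : Type _ := seriesSubalgebra 𝕜 I₀ I₁

instance : Ring (Series 𝕜 I₀ I₁) := inferInstanceAs (Ring (seriesSubalgebra 𝕜 I₀ I₁))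

instance : Algebra 𝕜 (Series 𝕜 I₀ I₁) :=
  inferInstanceAs (Algebra 𝕜 (seriesSubalgebra 𝕜 I₀ I₁))

variable {𝕜 I₀ I₁}

/-- The component `f_d` of degree `d` of a formal series. -/
def comp (d : ℕ) (f : Series 𝕜 I₀ I₁) : Poly 𝕜 I₀ I₁ := PowerSeries.coeff d f.1

/-- The formal series with prescribed homogeneous components. -/
def ofComp (u : ℕ → Poly 𝕜 I₀ I₁) (hu : ∀ d, u d ∈ homog 𝕜 I₀ I₁ d) : Series 𝕜 I₀ I₁ :=
  ⟨PowerSeries.mk u, fun d => by rw [PowerSeries.coeff_mk]; exact hu d⟩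

theorem comp_mem (d : ℕ) (f : Series 𝕜 I₀ I₁) : comp d f ∈ homog 𝕜 I₀ I₁ d := f.2 d

@[simp] theorem comp_ofComp (u : ℕ → Poly 𝕜 I₀ I₁) (hu) (d : ℕ) :
    comp d (ofComp u hu) = u d := PowerSeries.coeff_mk _ _

@[ext] theorem series_ext {f g : Series 𝕜 I₀ I₁} (h : ∀ d, comp d f = comp d g) : f = g :=
  Subtype.ext (PowerSeries.ext h)

@[simp] theorem comp_add (d : ℕ) (f g : Series 𝕜 I₀ I₁) :
    comp d (f + g) = comp d f + comp d g := rfl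

@[simp] theorem comp_sub (d : ℕ) (f g : Series 𝕜 I₀ I₁) :
    comp d (f - g) = comp d f - comp d g := rfl

@[simp] theorem comp_zero (d : ℕ) : comp d (0 : Series 𝕜 I₀ I₁) = 0 := rfl

@[simp] theorem comp_smul (d : ℕ) (c : 𝕜) (f : Series 𝕜 I₀ I₁) :
    comp d (c • f) = c • comp d f := rfl

theorem comp_mul (d : ℕ) (f g : Series 𝕜 I₀ I₁) :
    comp d (f * g) = ∑ p ∈ Finset.HasAntidiagonal.antidiagonal d, comp p.1 f * comp p.2 g :=
  PowerSeries.coeff_mul _ _ _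

/-- Apply componentwise a linear operator on polynomials that lowers the degree by `r`. -/
def lowerOp (r : ℕ) (g : Poly 𝕜 I₀ I₁ →ₗ[𝕜] Poly 𝕜 I₀ I₁)
    (hg : ∀ d, ∀ u ∈ homog 𝕜 I₀ I₁ (d + r), g u ∈ homog 𝕜 I₀ I₁ d) :
    Module.End 𝕜 (Series 𝕜 I₀ I₁) where
  toFun f := ofComp (fun d => g (comp (d + r) f)) fun d => hg d _ (comp_mem _ f)
  map_add' f h := by ext d; simp
  map_smul' c f := by ext d; simp

/-- The derivative `∂ₐ` on formal series. -/
def pdOp (a : I₀ ⊕ Option I₁) : Module.End 𝕜 (Series 𝕜 I₀ I₁) :=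
  lowerOp 1 (pd 𝕜 I₀ I₁ a) (pd_mem_homog a)

/-- Division by `ħ` on formal series; it inverts multiplication by `ħ` on its image. -/
def divHbarOp : Module.End 𝕜 (Series 𝕜 I₀ I₁) :=
  lowerOp 2 (divHbar 𝕜 I₀ I₁) divHbar_mem_homog

/-- The homogeneous polynomial `u` of degree `r` as a formal series. -/
def ofHomog (r : ℕ) (u : Poly 𝕜 I₀ I₁) (hu : u ∈ homog 𝕜 I₀ I₁ r) : Series 𝕜 I₀ I₁ :=
  ofComp (fun d => if d = r then u else 0) fun d => by
    split_ifs with h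
    · exact h ▸ hu
    · exact zero_mem _

/-- Left multiplication by a formal series. -/
def mulOp (f : Series 𝕜 I₀ I₁) : Module.End 𝕜 (Series 𝕜 I₀ I₁) := LinearMap.mulLeft 𝕜 f

/-- Multiplication by `ħ`. -/
def hbarOp : Module.End 𝕜 (Series 𝕜 I₀ I₁) :=
  mulOp (ofHomog 2 (hbar 𝕜 I₀ I₁) hbar_mem_homog)

/-- Multiplication by `xᵃ`. -/
def xOp (a : I₀ ⊕ Option I₁) : Module.End 𝕜 (Series 𝕜 I₀ I₁) :=
  mulOp (ofHomog 1 (gen 𝕜 I₀ I₁ a) (gen_mem_homog a))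

/-- All components of `f` of degree less than `n` vanish, that is `f ∈ 𝕜[[Ṽ, ħ]]^{≥ n}`.
These subspaces are the neighbourhood basis of zero in `𝕜[[Ṽ, ħ]]`. -/
def OrderGE (n : ℕ) (f : Series 𝕜 I₀ I₁) : Prop := ∀ d < n, comp d f = 0

/-- The operator `D` has only components of degree at least `r`: it raises degrees by at least
`r`. -/
def OpOrderGE (r : ℕ) (D : Module.End 𝕜 (Series 𝕜 I₀ I₁)) : Prop :=
  ∀ n f, OrderGE n f → OrderGE (n + r) (D f)

/-- `f` is homogeneous of parity `p` for the `ℤ/2`-grading. -/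
def HasParity (p : ZMod 2) (f : Series 𝕜 I₀ I₁) : Prop :=
  ∀ d, parityInv 𝕜 I₀ I₁ (comp d f) = (-1 : 𝕜) ^ p.val • comp d f

/-- The operator `D` is homogeneous of parity `p`. -/
def OpHasParity (p : ZMod 2) (D : Module.End 𝕜 (Series 𝕜 I₀ I₁)) : Prop :=
  ∀ q f, HasParity q f → HasParity (p + q) (D f)

end Series

section Weyl

variable (𝕜 : Type*) [Field 𝕜] (I₀ I₁ : Type*)

/-- The algebra of operators on `𝕜[[Ṽ, ħ]]` generated by `ħ`, the `xᵃ` and the `ħ∂ₐ`. -/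
def weylGenerated : Subalgebra 𝕜 (Module.End 𝕜 (Series 𝕜 I₀ I₁)) :=
  Algebra.adjoin 𝕜 ({hbarOp} ∪ Set.range xOp ∪ Set.range fun a => hbarOp * pdOp a)

variable {𝕜 I₀ I₁}

theorem mulOp_orderGE (r : ℕ) (g : Series 𝕜 I₀ I₁) (hg : OrderGE r g) :
    OpOrderGE r (mulOp g) := by
  intro n f hf d hd
  change comp d (g * f) = 0
  rw [comp_mul]
  refine Finset.sum_eq_zero fun p hp => ?_
  have hp' := Finset.HasAntidiagonal.mem_antidiagonal.mp hp
  by_cases h : p.1 < r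
  · rw [hg _ h, zero_mul]
  · rw [hf p.2 (by omega), mul_zero]

theorem ofHomog_orderGE (r : ℕ) (u : Poly 𝕜 I₀ I₁) (hu) : OrderGE r (ofHomog r u hu) := by
  intro d hd
  simp [ofHomog, hd.ne]

theorem weylGenerated_orderGE (D : Module.End 𝕜 (Series 𝕜 I₀ I₁))
    (hD : D ∈ weylGenerated 𝕜 I₀ I₁) : OpOrderGE 0 D := by
  induction hD using Algebra.adjoin_induction with
  | mem D hD =>
    rcases hD with (rfl | ⟨a, rfl⟩) | ⟨a, rfl⟩
    · exact fun n f hf d hd => mulOp_orderGE 2 _ (ofHomog_orderGE _ _ _) n f hf d (by omega)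
    · exact fun n f hf d hd => mulOp_orderGE 1 _ (ofHomog_orderGE _ _ _) n f hf d (by omega)
    · intro n f hf d hd
      have h1 : OrderGE (n - 1) (pdOp a f) := fun e he => by
        simp [pdOp, lowerOp, hf (e + 1) (by omega)]
      exact mulOp_orderGE 2 _ (ofHomog_orderGE _ _ _) (n - 1) _ h1 d (by omega)
  | algebraMap r =>
    intro n f hf d hd
    change comp d (r • f) = 0
    rw [comp_smul, hf d hd, smul_zero]
  | add D E _ _ hD hE =>
    intro n f hf d hd
    change comp d (D f + E f) = 0
    rw [comp_add, hD n f hf d hd, hE n f hf d hd, add_zero]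
  | mul D E _ _ hD hE => exact fun n f hf => hD n _ (hE n f hf)

variable (𝕜 I₀ I₁)

/-- The completed Weyl algebra `Ŵ_ħ(Ṽ)`: the closure, in the topology of pointwise convergence
of operators on `𝕜[[Ṽ, ħ]]`, of the algebra generated by `ħ`, the `xᵃ` and the `ħ∂ₐ`.
Operators `ħᵐ⁺ᵏ x^{i₁} ⋯ x^{iₙ} c_{i₁…iₙ}^{j₁…jₘ} ∂_{j₁} ⋯ ∂_{jₘ}` with infinitely many `j`, and
infinite sums of such operators of increasing degree, are pointwise limits of elements of that
algebra. -/
def Weyl : Subalgebra 𝕜 (Module.End 𝕜 (Series 𝕜 I₀ I₁)) where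
  carrier := {T | ∀ (s : Finset (Series 𝕜 I₀ I₁)) (n : ℕ),
    ∃ D ∈ weylGenerated 𝕜 I₀ I₁, ∀ f ∈ s, OrderGE n (T f - D f)}
  mul_mem' := by
    classical
    intro T U hT hU s n
    obtain ⟨D, hD, hDs⟩ := hT (s.image U) n
    obtain ⟨E, hE, hEs⟩ := hU s n
    refine ⟨D * E, mul_mem hD hE, fun f hf d hd => ?_⟩
    have h1 := hDs (U f) (Finset.mem_image_of_mem _ hf) d hd
    have h2 := weylGenerated_orderGE D hD n _ (hEs f hf) d hd
    have h3 : (T * U) f - (D * E) f = (T (U f) - D (U f)) + D (U f - E f) := by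
      simp
    rw [h3, comp_add, h1, h2, add_zero]
  add_mem' := by
    intro T U hT hU s n
    obtain ⟨D, hD, hDs⟩ := hT s n
    obtain ⟨E, hE, hEs⟩ := hU s n
    refine ⟨D + E, add_mem hD hE, fun f hf d hd => ?_⟩
    have h3 : (T + U) f - (D + E) f = (T f - D f) + (U f - E f) := by
      simp only [LinearMap.add_apply]; abel
    rw [h3, comp_add, hDs f hf d hd, hEs f hf d hd, add_zero]
  algebraMap_mem' r s n :=
    ⟨_, (weylGenerated 𝕜 I₀ I₁).algebraMap_mem r, fun f _ d _ => by simp⟩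

variable {𝕜 I₀ I₁}

theorem weylGenerated_le : weylGenerated 𝕜 I₀ I₁ ≤ Weyl 𝕜 I₀ I₁ :=
  fun D hD _ _ => ⟨D, hD, fun f _ d _ => by simp⟩

/-- `ħ` as an element of the completed Weyl algebra. -/
def hbarWeyl : Weyl 𝕜 I₀ I₁ :=
  ⟨hbarOp, weylGenerated_le (Algebra.subset_adjoin (Or.inl (Or.inl rfl)))⟩

/-- `-(1/ħ)[F, D]` for an even series `F`. -/
def adOp (F : Series 𝕜 I₀ I₁) (D : Module.End 𝕜 (Series 𝕜 I₀ I₁)) :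
    Module.End 𝕜 (Series 𝕜 I₀ I₁) :=
  -(divHbarOp * (mulOp F * D - D * mulOp F))

/-- `ψ_F(D) = ∑ₙ (1/n!) (-(1/ħ)[F, ·])ⁿ(D)`, for `F` even of order at least `3` and `D` in the
completed Weyl algebra. Since the `n`-th term raises degrees by at least `n`, only the terms with
`n ≤ d` contribute to the component of degree `d` of `ψ_F(D) f`. -/
def psi (F : Series 𝕜 I₀ I₁) (D : Module.End 𝕜 (Series 𝕜 I₀ I₁)) :
    Module.End 𝕜 (Series 𝕜 I₀ I₁) where
  toFun f := ofComp
    (fun d => ∑ n ∈ Finset.range (d + 1), (n.factorial : 𝕜)⁻¹ • comp d (((adOp F)^[n] D) f))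
    fun _ => sum_mem fun _ _ => Submodule.smul_mem _ _ (comp_mem _ _)
  map_add' f g := by
    ext d
    simp [Finset.sum_add_distrib]
  map_smul' c f := by
    ext d
    simp [Finset.smul_sum, smul_comm c]

end Weyl

section Airy

variable {𝕜 : Type*} [Field 𝕜] {I₀ I₁ : Type*} {V : Type*} [AddCommGroup V] [Module 𝕜 V]

/-- The inclusion of the index set of a basis of `V` in that of `Ṽ = V ⊕ 𝕜^{0|1}`. -/
def incl : I₀ ⊕ I₁ → I₀ ⊕ Option I₁ := Sum.map id some

/-- `(V, L)` is a super quantum Airy structure. Here `𝒱` is the `ℤ/2`-grading of the super vector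
space `V`, and `b` is a homogeneous basis of `V`, with even part indexed by `I₀` and odd part
indexed by `I₁`. -/
structure IsSuperQuantumAiryStructure (𝒱 : ZMod 2 → Submodule 𝕜 V)
    (b : Module.Basis (I₀ ⊕ I₁) 𝕜 V) (L : Module.Dual 𝕜 V →ₗ[𝕜] Weyl 𝕜 I₀ I₁) : Prop where
  /-- `L` preserves parity; a functional has parity `p` if it vanishes on the part of `V` of the
  other parity. -/
  even : ∀ (p : ZMod 2) (φ : Module.Dual 𝕜 V), (∀ v ∈ 𝒱 (p + 1), φ v = 0) →
    OpHasParity p (L φ : Module.End 𝕜 (Series 𝕜 I₀ I₁))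
  /-- `L` is continuous, for the topologies of pointwise convergence on `V^*` (with discrete
  scalars) and on the completed Weyl algebra. -/
  continuous : ∀ (f : Series 𝕜 I₀ I₁) (n : ℕ), ∃ s : Finset V, ∀ φ : Module.Dual 𝕜 V,
    (∀ v ∈ s, φ v = 0) → OrderGE n ((L φ : Module.End 𝕜 (Series 𝕜 I₀ I₁)) f)
  /-- The left ideal `𝔏` generated by the image of `L` satisfies `[𝔏, 𝔏] ⊆ ħ 𝔏`, where `[·, ·]` is
  the supercommutator; as `𝔏` is spanned by homogeneous elements, it suffices to say this for
  homogeneous elements. (In Mathlib, ideals of a noncommutative ring are left ideals.) -/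
  involutive : ∀ (p q : ZMod 2), ∀ D ∈ Ideal.span (Set.range L), ∀ E ∈ Ideal.span (Set.range L),
    OpHasParity p D.1 → OpHasParity q E.1 →
    ∃ G ∈ Ideal.span (Set.range L),
      D * E - (-1 : 𝕜) ^ (p.val * q.val) • (E * D) = hbarWeyl * G
  /-- `L(yᵢ)^{≤ 1} = ħ∂ᵢ`. -/
  leading : ∀ i : I₀ ⊕ I₁, OpOrderGE 2
    ((L (b.coord i) : Module.End 𝕜 (Series 𝕜 I₀ I₁)) - hbarOp * pdOp (incl i))

/-- `F` is a free energy of `(V, L)`. -/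
structure IsFreeEnergy (L : Module.Dual 𝕜 V →ₗ[𝕜] Weyl 𝕜 I₀ I₁) (F : Series 𝕜 I₀ I₁) :
    Prop where
  /-- `F` is even. -/
  even : HasParity 0 F
  /-- All terms of `F` have degree at least `3`. -/
  order : OrderGE 3 F
  /-- `F` has no term independent of the `xᵃ`: each component lies in the ideal generated by
  the `xᵃ`. -/
  no_constant : ∀ d, comp d F ∈ Ideal.span (Set.range (gen 𝕜 I₀ I₁))
  /-- `ψ_F(L(φ)) · 1 = 0` for all `φ`. -/
  annihilates : ∀ φ : Module.Dual 𝕜 V, psi F (L φ : Module.End 𝕜 (Series 𝕜 I₀ I₁)) 1 = 0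

end Airy

end SuperAiry

end

/-!
The free energy is found degree by degree. Write `y i` for the coordinate functionals and
`ψ_F(D) = e^{-F/ħ} D e^{F/ħ}`. Since `L(y i) = ħ∂ᵢ + (terms of order ≥ 2)`, adding to `F` a series
`H` of order at least `d` changes `ψ_F(L(y i)) · 1` by `∂ᵢH` up to terms of order at least `d`
(`psi_add_coord_orderGE`). Hence, if `F` solves the equations below degree `d - 1`, the component
of degree `d` to be added must satisfy `∂ᵢH = -uᵢ` for all `i ∈ I`, where `uᵢ` is the component of
degree `d - 1` of `ψ_F(L(y i)) · 1`.

Uniqueness: if `∂ᵢH = 0` for all `i ∈ I`, then `H` is a polynomial in `ħ` and the odd variable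
`x⁰`. Being even it does not contain `x⁰`, and having no constant term it vanishes
(`eq_zero_of_pd_eq_zero`).

Existence: `-(1/ħ)[F, ·]` is a derivation of the completed Weyl algebra (`adOp_spec`, `adOp_mul`),
so that `ψ_F` is multiplicative on it (`psi_mul`). Applying `ψ_F` to `[L(y i), L(y j)] ∈ ħ𝔏` and
evaluating on `1` shows in lowest degree that `∂ᵢuⱼ = ± ∂ⱼuᵢ` (`pd_obstruction`). By continuity of
`L` only finitely many `uᵢ` are nonzero, so the closed form `u` has a polynomial primitive by the
super Poincaré lemma (`exists_primitive`); the latter inverts the Euler operator `E = ∑ xⁱ∂ᵢ` of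
the finitely many variables involved, which is diagonalizable with eigenvalues in `ℕ`. Continuity
also passes from the coordinate functionals to all of `V^*` (`psi_orderGE_of_coord`).
-/

noncomputable section

namespace SuperAiry

/-! ### Signs and the super Leibniz rule on polynomials -/

section PolyCalculus

variable {𝕜 : Type*} [Field 𝕜] {I₀ I₁ : Type*}

/-- The parity of the variable `xᵃ`. -/
def par : I₀ ⊕ Option I₁ → ZMod 2
  | Sum.inl _ => 0
  | Sum.inr _ => 1

variable (𝕜) in
/-- The sign `(-1)^p` of a parity `p`, as a scalar. -/
def parSign (p : ZMod 2) : 𝕜 := (-1) ^ p.val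

theorem parSign_zero : parSign 𝕜 0 = 1 := by simp [parSign]

theorem parSign_one : parSign 𝕜 1 = -1 := by simp [parSign, ZMod.val_one]

theorem zmod_two_cases (p : ZMod 2) : p = 0 ∨ p = 1 := by
  fin_cases p
  · exact Or.inl rfl
  · exact Or.inr rfl

theorem parSign_add (p q : ZMod 2) : parSign 𝕜 (p + q) = parSign 𝕜 p * parSign 𝕜 q := by
  have h2 : (1 + 1 : ZMod 2) = 0 := rfl
  rcases zmod_two_cases p with rfl | rfl <;> rcases zmod_two_cases q with rfl | rfl <;>
    simp [parSign_zero, parSign_one, h2]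

variable (𝕜) in
/-- The sign `(-1)^{|a||b|}` for exchanging `xᵃ` and `xᵇ`. -/
def swapSign (a b : I₀ ⊕ Option I₁) : 𝕜 := (-1) ^ ((par a).val * (par b).val)

theorem swapSign_mul_self (a b : I₀ ⊕ Option I₁) : swapSign 𝕜 a b * swapSign 𝕜 a b = 1 := by
  rw [swapSign, ← mul_pow]
  simp

/-- The sign picked up by a polynomial when `xᵃ` moves past it: the parity involution if `xᵃ` is
odd, and the identity if it is even. -/
def twist : I₀ ⊕ Option I₁ → (Poly 𝕜 I₀ I₁ →ₐ[𝕜] Poly 𝕜 I₀ I₁)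
  | Sum.inl _ => AlgHom.id 𝕜 _
  | Sum.inr _ => parityInv 𝕜 I₀ I₁

theorem parityInv_parityInv (u : Poly 𝕜 I₀ I₁) :
    parityInv 𝕜 I₀ I₁ (parityInv 𝕜 I₀ I₁ u) = u := by
  induction u using poly_induction with
  | zero => simp
  | tmul p w => simp [parityInv_tm]
  | add u v hu hv => simp only [map_add, hu, hv]

theorem twist_twist (a : I₀ ⊕ Option I₁) (u : Poly 𝕜 I₀ I₁) : twist a (twist a u) = u := by
  rcases a with i | j
  · rfl
  · exact parityInv_parityInv u

theorem parityInv_gen (a : I₀ ⊕ Option I₁) :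
    parityInv 𝕜 I₀ I₁ (gen 𝕜 I₀ I₁ a) = parSign 𝕜 (par a) • gen 𝕜 I₀ I₁ a := by
  rcases a with i | j
  · simp [gen, parityInv_tm, par, parSign_zero]
  · have h : CliffordAlgebra.involute (ExteriorAlgebra.ι 𝕜 (Finsupp.single j (1 : 𝕜))) =
        (-1 : 𝕜) • ExteriorAlgebra.ι 𝕜 (Finsupp.single j (1 : 𝕜)) := by
      rw [neg_one_smul]
      exact CliffordAlgebra.involute_ι _
    simp only [gen, parityInv_tm, par, parSign_one, h, tm_smul_right]

theorem parityInv_hbar : parityInv 𝕜 I₀ I₁ (hbar 𝕜 I₀ I₁) = hbar 𝕜 I₀ I₁ := by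
  simp [hbar, parityInv_tm]

theorem twist_of_parity {p : ZMod 2} (a : I₀ ⊕ Option I₁) {u : Poly 𝕜 I₀ I₁}
    (hu : parityInv 𝕜 I₀ I₁ u = parSign 𝕜 p • u) :
    twist a u = (-1 : 𝕜) ^ ((par a).val * p.val) • u := by
  rcases a with i | j
  · simp [twist, par]
  · simpa [twist, par, ZMod.val_one, parSign] using hu

theorem twist_gen (a b : I₀ ⊕ Option I₁) :
    twist a (gen 𝕜 I₀ I₁ b) = swapSign 𝕜 a b • gen 𝕜 I₀ I₁ b :=
  twist_of_parity a (parityInv_gen b)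

/-- Supercommutativity of the exterior algebra. -/
theorem ι_mul_eq (m : Option I₁ →₀ 𝕜) (w : ExteriorAlgebra 𝕜 (Option I₁ →₀ 𝕜)) :
    ExteriorAlgebra.ι 𝕜 m * w = CliffordAlgebra.involute w * ExteriorAlgebra.ι 𝕜 m := by
  induction w using CliffordAlgebra.left_induction with
  | algebraMap r => rw [AlgHom.commutes]; exact (Algebra.commutes r _).symm
  | add x y hx hy => rw [mul_add, map_add, add_mul, hx, hy]
  | ι_mul x n hx =>
    have h : ExteriorAlgebra.ι 𝕜 m * ExteriorAlgebra.ι 𝕜 n =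
        -(ExteriorAlgebra.ι 𝕜 n * ExteriorAlgebra.ι 𝕜 m) :=
      eq_neg_of_add_eq_zero_left (ExteriorAlgebra.ι_add_mul_swap m n)
    have h' : CliffordAlgebra.involute (ExteriorAlgebra.ι 𝕜 n * x) =
        -(ExteriorAlgebra.ι 𝕜 n * CliffordAlgebra.involute x) := by
      rw [map_mul, ← neg_mul]
      exact congrArg (· * _) (CliffordAlgebra.involute_ι n)
    change ExteriorAlgebra.ι 𝕜 m * (ExteriorAlgebra.ι 𝕜 n * x) =
      CliffordAlgebra.involute (ExteriorAlgebra.ι 𝕜 n * x) * ExteriorAlgebra.ι 𝕜 m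
    rw [h', ← mul_assoc, h, neg_mul, neg_mul, mul_assoc, hx, mul_assoc]

/-- Supercommutativity. -/
theorem gen_mul_eq (a : I₀ ⊕ Option I₁) (u : Poly 𝕜 I₀ I₁) :
    gen 𝕜 I₀ I₁ a * u = twist a u * gen 𝕜 I₀ I₁ a := by
  induction u using poly_induction with
  | zero => simp
  | tmul p w =>
    rcases a with i | j
    · simp [twist, gen, tm_mul, mul_comm]
    · simp [twist, gen, tm_mul, parityInv_tm, ι_mul_eq]
  | add u v hu hv => rw [mul_add, map_add, add_mul, hu, hv]

/-- Contraction is an antiderivation of the exterior algebra. -/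
theorem oddPd_mul (j : Option I₁) (v w : ExteriorAlgebra 𝕜 (Option I₁ →₀ 𝕜)) :
    oddPd 𝕜 I₁ j (v * w) = oddPd 𝕜 I₁ j v * w + CliffordAlgebra.involute v * oddPd 𝕜 I₁ j w := by
  induction v using CliffordAlgebra.left_induction with
  | algebraMap r =>
    rw [AlgHom.commutes, ← Algebra.smul_def, ← Algebra.smul_def, map_smul,
      Algebra.algebraMap_eq_smul_one, map_smul, oddPd_one]
    simp
  | add x y hx hy => simp only [map_add, add_mul, hx, hy]; abel
  | ι_mul x n hx =>
    have h (y : ExteriorAlgebra 𝕜 (Option I₁ →₀ 𝕜)) :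
        oddPd 𝕜 I₁ j (CliffordAlgebra.ι 0 n * y) =
          n j • y - CliffordAlgebra.ι 0 n * oddPd 𝕜 I₁ j y :=
      CliffordAlgebra.contractLeft_ι_mul _ _ _
    have h1 : oddPd 𝕜 I₁ j (CliffordAlgebra.ι 0 n * x * w) =
        n j • (x * w) - CliffordAlgebra.ι 0 n * oddPd 𝕜 I₁ j (x * w) := by
      rw [← h]
      exact congrArg (oddPd 𝕜 I₁ j) (mul_assoc _ _ _)
    have h2 : CliffordAlgebra.involute (CliffordAlgebra.ι 0 n * x) =
        -(CliffordAlgebra.ι (0 : QuadraticForm 𝕜 (Option I₁ →₀ 𝕜)) n *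
          CliffordAlgebra.involute x) := by
      rw [map_mul, CliffordAlgebra.involute_ι, neg_mul]
    have h3 := h x
    -- The multiplications of the Clifford algebra of the zero form and of the exterior algebra
    -- agree only up to unfolding, so the goal is restated in the exterior algebra before expanding.
    set c := CliffordAlgebra.ι (0 : QuadraticForm 𝕜 (Option I₁ →₀ 𝕜)) n
    refine h1.trans ?_
    rw [hx, h3]
    refine Eq.trans ?_ (congrArg (fun z : ExteriorAlgebra 𝕜 (Option I₁ →₀ 𝕜) =>
      (n j • x - c * oddPd 𝕜 I₁ j x) * w + z * oddPd 𝕜 I₁ j w) h2.symm)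
    change n j • (x * w) - (c : ExteriorAlgebra 𝕜 (Option I₁ →₀ 𝕜)) * _ = _
    generalize (CliffordAlgebra.involute x : ExteriorAlgebra 𝕜 (Option I₁ →₀ 𝕜)) = x'
    generalize hc : (c : ExteriorAlgebra 𝕜 (Option I₁ →₀ 𝕜)) = c'
    rw [mul_add, sub_mul, smul_mul_assoc, neg_mul, mul_assoc, mul_assoc]
    abel

/-- The super Leibniz rule. -/
theorem pd_mul (a : I₀ ⊕ Option I₁) (u v : Poly 𝕜 I₀ I₁) :
    pd 𝕜 I₀ I₁ a (u * v) = pd 𝕜 I₀ I₁ a u * v + twist a u * pd 𝕜 I₀ I₁ a v := by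
  induction u using poly_induction with
  | zero => simp
  | add u u' hu hu' => simp only [map_add, add_mul, hu, hu']; abel
  | tmul p w =>
    induction v using poly_induction with
    | zero => simp
    | add v v' hv hv' => simp only [map_add, mul_add, hv, hv']; abel
    | tmul q z =>
      rcases a with i | j
      · simp only [tm_mul, pd_inl_tm, twist, AlgHom.coe_id, id, ← tm_add_left,
          MvPolynomial.pderiv_mul]
      · simp only [tm_mul, pd_inr_tm, twist, parityInv_tm, ← tm_add_right, oddPd_mul]

open Classical in
theorem pd_gen (a b : I₀ ⊕ Option I₁) :
    pd 𝕜 I₀ I₁ a (gen 𝕜 I₀ I₁ b) = if a = b then 1 else 0 := by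
  rcases a with i | j <;> rcases b with i' | j'
  · by_cases h : i = i'
    · subst h; simp [gen, pd_inl_tm, one_eq_tm]
    · simp [gen, pd_inl_tm, MvPolynomial.pderiv_X, h, eq_comm, tm_zero_left]
  · simp [gen, pd_inl_tm, tm_zero_left]
  · simp [gen, pd_inr_tm, oddPd_one, tm_zero_right]
  · have h := oddPd_ι_mul (𝕜 := 𝕜) j j' 1
    rw [oddPd_one, mul_zero, mul_one, sub_zero] at h
    simp only [gen, pd_inr_tm, h, Sum.inr.injEq]
    by_cases hj : j = j'
    · subst hj; simp [one_eq_tm]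
    · simp [hj, tm_zero_right]

theorem pd_hbar (a : I₀ ⊕ Option I₁) : pd 𝕜 I₀ I₁ a (hbar 𝕜 I₀ I₁) = 0 := by
  have h := pd_hbar_mul (𝕜 := 𝕜) a 1
  rwa [mul_one, pd_one, mul_zero] at h

theorem oddPd_involute (j : Option I₁) (w : ExteriorAlgebra 𝕜 (Option I₁ →₀ 𝕜)) :
    CliffordAlgebra.involute (oddPd 𝕜 I₁ j w) =
      -oddPd 𝕜 I₁ j (CliffordAlgebra.involute w) := by
  induction w using CliffordAlgebra.left_induction with
  | algebraMap r =>
    rw [AlgHom.commutes, Algebra.algebraMap_eq_smul_one, map_smul, oddPd_one]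
    simp
  | add x y hx hy => simp only [map_add, hx, hy]; abel
  | ι_mul x n hx =>
    have h (y : ExteriorAlgebra 𝕜 (Option I₁ →₀ 𝕜)) :
        oddPd 𝕜 I₁ j (CliffordAlgebra.ι 0 n * y) =
          n j • y - CliffordAlgebra.ι 0 n * oddPd 𝕜 I₁ j y :=
      CliffordAlgebra.contractLeft_ι_mul _ _ _
    rw [h, map_mul, CliffordAlgebra.involute_ι, neg_mul, map_neg, h, neg_neg, map_sub, map_smul,
      map_mul, CliffordAlgebra.involute_ι, hx, neg_mul_neg]

/-- Taking the derivative `∂ₐ` changes the parity by that of `xᵃ`. -/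
theorem parityInv_pd (a : I₀ ⊕ Option I₁) (u : Poly 𝕜 I₀ I₁) :
    parityInv 𝕜 I₀ I₁ (pd 𝕜 I₀ I₁ a u) =
      parSign 𝕜 (par a) • pd 𝕜 I₀ I₁ a (parityInv 𝕜 I₀ I₁ u) := by
  induction u using poly_induction with
  | zero => simp
  | add u v hu hv => simp only [map_add, hu, hv, smul_add]
  | tmul p w =>
    rcases a with i | j
    · simp only [pd_inl_tm, parityInv_tm, par, parSign_zero, one_smul]
    · simp only [pd_inr_tm, parityInv_tm, par, parSign_one, oddPd_involute]
      rw [← neg_one_smul 𝕜, tm_smul_right]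

theorem parityInv_divHbar (u : Poly 𝕜 I₀ I₁) :
    parityInv 𝕜 I₀ I₁ (divHbar 𝕜 I₀ I₁ u) = divHbar 𝕜 I₀ I₁ (parityInv 𝕜 I₀ I₁ u) := by
  induction u using poly_induction with
  | zero => simp
  | add u v hu hv => simp only [map_add, hu, hv]
  | tmul p w => simp only [divHbar_tm, parityInv_tm]

theorem pderiv_pderiv_comm (i j : Option I₀) (p : MvPolynomial (Option I₀) 𝕜) :
    MvPolynomial.pderiv i (MvPolynomial.pderiv j p) =
      MvPolynomial.pderiv j (MvPolynomial.pderiv i p) := by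
  classical
  have h : ⁅MvPolynomial.pderiv (R := 𝕜) i, MvPolynomial.pderiv (R := 𝕜) j⁆ = 0 := by
    refine MvPolynomial.derivation_ext fun k => ?_
    rw [Derivation.commutator_apply, MvPolynomial.pderiv_X, MvPolynomial.pderiv_X,
      Pi.single_apply, Pi.single_apply]
    split_ifs <;> simp
  have h1 := DFunLike.congr_fun h p
  rw [Derivation.commutator_apply] at h1
  exact sub_eq_zero.mp h1

theorem pd_pd_comm (a b : I₀ ⊕ Option I₁) (u : Poly 𝕜 I₀ I₁) :
    pd 𝕜 I₀ I₁ a (pd 𝕜 I₀ I₁ b u) = swapSign 𝕜 a b • pd 𝕜 I₀ I₁ b (pd 𝕜 I₀ I₁ a u) := by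
  induction u using poly_induction with
  | zero => simp
  | add u v hu hv => simp only [map_add, hu, hv, smul_add]
  | tmul p w =>
    rcases a with i | j <;> rcases b with i' | j'
    · simp [pd_inl_tm, swapSign, par, pderiv_pderiv_comm (some i) (some i')]
    · simp [pd_inl_tm, pd_inr_tm, swapSign, par]
    · simp [pd_inl_tm, pd_inr_tm, swapSign, par]
    · have h : oddPd 𝕜 I₁ j (oddPd 𝕜 I₁ j' w) = -oddPd 𝕜 I₁ j' (oddPd 𝕜 I₁ j w) :=
        CliffordAlgebra.contractLeft_comm _ _ _
      simp only [pd_inr_tm, swapSign, par, ZMod.val_one, mul_one, pow_one, h]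
      rw [← neg_one_smul 𝕜, tm_smul_right]

theorem pd_of_mem_homog_zero (a : I₀ ⊕ Option I₁) {u : Poly 𝕜 I₀ I₁}
    (hu : u ∈ homog 𝕜 I₀ I₁ 0) : pd 𝕜 I₀ I₁ a u = 0 := by
  induction hu using Submodule.span_induction with
  | mem x hx =>
    obtain ⟨k, l, hd, rfl⟩ := hx
    obtain rfl : k = 0 := by omega
    obtain rfl : l = [] := List.length_eq_zero_iff.mp (by omega)
    simp [pd_one]
  | zero => simp
  | add x y _ _ hx hy => rw [map_add, hx, hy, add_zero]
  | smul c x _ hx => rw [map_smul, hx, smul_zero]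

theorem parityInv_mem_homog {d : ℕ} {u : Poly 𝕜 I₀ I₁} (hu : u ∈ homog 𝕜 I₀ I₁ d) :
    parityInv 𝕜 I₀ I₁ u ∈ homog 𝕜 I₀ I₁ d := by
  have key (l : List (I₀ ⊕ Option I₁)) : ∃ c : 𝕜,
      parityInv 𝕜 I₀ I₁ (l.map (gen 𝕜 I₀ I₁)).prod = c • (l.map (gen 𝕜 I₀ I₁)).prod := by
    induction l with
    | nil => exact ⟨1, by simp⟩
    | cons b l ih =>
      obtain ⟨c, hc⟩ := ih
      exact ⟨parSign 𝕜 (par b) * c, by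
        rw [List.map_cons, List.prod_cons, map_mul, hc, parityInv_gen, smul_mul_smul_comm]⟩
  induction hu using Submodule.span_induction with
  | mem x hx =>
    obtain ⟨k, l, rfl, rfl⟩ := hx
    obtain ⟨c, hc⟩ := key l
    rw [map_mul, map_pow, parityInv_hbar, hc, mul_smul_comm]
    exact Submodule.smul_mem _ _ (mem_homog k l)
  | zero => rw [map_zero]; exact zero_mem _
  | add x y _ _ hx hy => rw [map_add]; exact add_mem hx hy
  | smul c x _ hx => rw [map_smul]; exact Submodule.smul_mem _ _ hx

/-- Even polynomials are central. -/
theorem commute_of_even {u v : Poly 𝕜 I₀ I₁} (hu : parityInv 𝕜 I₀ I₁ u = u) {d : ℕ}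
    (hv : v ∈ homog 𝕜 I₀ I₁ d) : Commute u v := by
  have hgen (a : I₀ ⊕ Option I₁) : Commute u (gen 𝕜 I₀ I₁ a) := by
    have h : twist a u = u := by
      rcases a with i | j
      · rfl
      · exact hu
    rw [Commute, SemiconjBy, gen_mul_eq a u, h]
  induction hv using Submodule.span_induction with
  | mem x hx =>
    obtain ⟨k, l, -, rfl⟩ := hx
    refine ((hbar_commute u).symm.pow_right k).mul_right ?_
    refine Commute.list_prod_right _ _ fun x hx => ?_
    obtain ⟨a, -, rfl⟩ := List.mem_map.mp hx
    exact hgen a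
  | zero => exact Commute.zero_right _
  | add x y _ _ hx hy => exact hx.add_right hy
  | smul c x _ hx => exact hx.smul_right c

theorem gen_mul_mem_ideal (a : I₀ ⊕ Option I₁) (u : Poly 𝕜 I₀ I₁) :
    gen 𝕜 I₀ I₁ a * u ∈ Ideal.span (Set.range (gen 𝕜 I₀ I₁)) := by
  rw [gen_mul_eq]
  exact Ideal.mul_mem_left _ _ (Ideal.subset_span ⟨a, rfl⟩)

variable (𝕜 I₀ I₁) in
/-- The algebra homomorphism sending `ħ` to `1` and all `xᵃ` to `0`. -/
def augment : Poly 𝕜 I₀ I₁ →ₐ[𝕜] 𝕜 :=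
  Algebra.TensorProduct.lift
    (MvPolynomial.aeval fun o : Option I₀ => if o = none then (1 : 𝕜) else 0)
    ExteriorAlgebra.algebraMapInv fun _ _ => Commute.all _ _

theorem augment_tm (p : MvPolynomial (Option I₀) 𝕜)
    (w : ExteriorAlgebra 𝕜 (Option I₁ →₀ 𝕜)) :
    augment 𝕜 I₀ I₁ (tm 𝕜 I₀ I₁ p w) =
      MvPolynomial.aeval (fun o : Option I₀ => if o = none then (1 : 𝕜) else 0) p *
        ExteriorAlgebra.algebraMapInv w :=
  Algebra.TensorProduct.lift_tmul _ _ _ _ _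

theorem augment_eq_zero {u : Poly 𝕜 I₀ I₁}
    (hu : u ∈ Ideal.span (Set.range (gen 𝕜 I₀ I₁))) : augment 𝕜 I₀ I₁ u = 0 := by
  induction hu using Submodule.span_induction with
  | mem x hx =>
    obtain ⟨a, rfl⟩ := hx
    rcases a with i | j <;> simp [gen, augment_tm, ExteriorAlgebra.algebraMapInv]
  | zero => simp
  | add x y _ _ hx hy => rw [map_add, hx, hy, add_zero]
  | smul c x _ hx => rw [smul_eq_mul, map_mul, hx, mul_zero]

theorem augment_hbar : augment 𝕜 I₀ I₁ (hbar 𝕜 I₀ I₁) = 1 := by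
  simp [hbar, augment_tm]

end PolyCalculus

/-! ### The Poincaré lemma for super polynomials -/

section Poincare

variable {𝕜 : Type*} [Field 𝕜] {I₀ I₁ : Type*}

/-- The Euler operator `∑ xᵃ∂ₐ` of a finite set of variables. -/
def euler (J : Finset (I₀ ⊕ Option I₁)) : Module.End 𝕜 (Poly 𝕜 I₀ I₁) :=
  ∑ a ∈ J, LinearMap.mulLeft 𝕜 (gen 𝕜 I₀ I₁ a) ∘ₗ pd 𝕜 I₀ I₁ a

theorem euler_apply (J : Finset (I₀ ⊕ Option I₁)) (u : Poly 𝕜 I₀ I₁) :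
    euler J u = ∑ a ∈ J, gen 𝕜 I₀ I₁ a * pd 𝕜 I₀ I₁ a u := by
  simp [euler, LinearMap.sum_apply]

/-- The Euler operator is an even derivation. -/
theorem euler_mul (J : Finset (I₀ ⊕ Option I₁)) (u v : Poly 𝕜 I₀ I₁) :
    euler J (u * v) = euler J u * v + u * euler J v := by
  simp only [euler_apply, Finset.sum_mul, Finset.mul_sum, ← Finset.sum_add_distrib]
  refine Finset.sum_congr rfl fun a _ => ?_
  rw [pd_mul, mul_add, ← mul_assoc, ← mul_assoc, gen_mul_eq a (twist a u), twist_twist, mul_assoc,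
    mul_assoc]

open Classical in
theorem euler_gen (J : Finset (I₀ ⊕ Option I₁)) (b : I₀ ⊕ Option I₁) :
    euler J (gen 𝕜 I₀ I₁ b) = if b ∈ J then gen 𝕜 I₀ I₁ b else 0 := by
  simp [euler_apply, pd_gen]

theorem euler_hbar_pow_mul (J : Finset (I₀ ⊕ Option I₁)) (k : ℕ) (u : Poly 𝕜 I₀ I₁) :
    euler J (hbar 𝕜 I₀ I₁ ^ k * u) = hbar 𝕜 I₀ I₁ ^ k * euler J u := by
  induction k with
  | zero => simp
  | succ k ih =>
    have h : euler J (hbar 𝕜 I₀ I₁) = 0 := by simp [euler_apply, pd_hbar]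
    rw [pow_succ', mul_assoc, euler_mul, h, ih, zero_mul, zero_add, mul_assoc]

open Classical in
/-- Monomials are eigenvectors of the Euler operator, with eigenvalue the number of factors
in `J`. -/
theorem euler_monomial (J : Finset (I₀ ⊕ Option I₁)) (k : ℕ) (l : List (I₀ ⊕ Option I₁)) :
    euler J (hbar 𝕜 I₀ I₁ ^ k * (l.map (gen 𝕜 I₀ I₁)).prod) =
      (l.countP (· ∈ J) : 𝕜) • (hbar 𝕜 I₀ I₁ ^ k * (l.map (gen 𝕜 I₀ I₁)).prod) := by
  have h : euler J (l.map (gen 𝕜 I₀ I₁)).prod =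
      (l.countP (· ∈ J) : 𝕜) • (l.map (gen 𝕜 I₀ I₁)).prod := by
    induction l with
    | nil => simp [euler_apply, pd_one]
    | cons b l ih =>
      rw [List.map_cons, List.prod_cons, euler_mul, ih, euler_gen, List.countP_cons]
      by_cases hb : b ∈ J
      · simp [hb, add_smul, add_comm]
      · simp [hb]
  rw [euler_hbar_pow_mul, h, mul_smul_comm]

theorem pd_euler_of_mem {J : Finset (I₀ ⊕ Option I₁)} {a : I₀ ⊕ Option I₁} (ha : a ∈ J)
    (u : Poly 𝕜 I₀ I₁) :
    pd 𝕜 I₀ I₁ a (euler J u) = pd 𝕜 I₀ I₁ a u + euler J (pd 𝕜 I₀ I₁ a u) := by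
  classical
  have h (b : I₀ ⊕ Option I₁) : pd 𝕜 I₀ I₁ a (gen 𝕜 I₀ I₁ b * pd 𝕜 I₀ I₁ b u) =
      (if a = b then pd 𝕜 I₀ I₁ a u else 0) +
        gen 𝕜 I₀ I₁ b * pd 𝕜 I₀ I₁ b (pd 𝕜 I₀ I₁ a u) := by
    rw [pd_mul, pd_gen, twist_gen, pd_pd_comm a b, smul_mul_smul_comm, swapSign_mul_self, one_smul]
    congr 1
    split_ifs with hab
    · rw [hab, one_mul]
    · rw [zero_mul]
  simp only [euler_apply, map_sum, h, Finset.sum_add_distrib]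
  simp [ha]

theorem pd_euler_of_notMem {J : Finset (I₀ ⊕ Option I₁)} {a : I₀ ⊕ Option I₁} (ha : a ∉ J)
    (u : Poly 𝕜 I₀ I₁) :
    pd 𝕜 I₀ I₁ a (euler J u) = euler J (pd 𝕜 I₀ I₁ a u) := by
  classical
  simp only [euler_apply, map_sum]
  refine Finset.sum_congr rfl fun b hb => ?_
  have hab : a ≠ b := fun h => ha (h ▸ hb)
  rw [pd_mul, pd_gen, twist_gen, pd_pd_comm a b, smul_mul_smul_comm, swapSign_mul_self, one_smul,
    if_neg hab, zero_mul, zero_add]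

theorem parityInv_euler (J : Finset (I₀ ⊕ Option I₁)) (u : Poly 𝕜 I₀ I₁) :
    parityInv 𝕜 I₀ I₁ (euler J u) = euler J (parityInv 𝕜 I₀ I₁ u) := by
  simp only [euler_apply, map_sum, map_mul, parityInv_gen, parityInv_pd, smul_mul_smul_comm,
    ← parSign_add]
  refine Finset.sum_congr rfl fun a _ => ?_
  rw [show par a + par a = 0 from CharTwo.add_self_eq_zero _, parSign_zero, one_smul]

variable [CharZero 𝕜]

theorem eq_zero_of_eq_neg {u : Poly 𝕜 I₀ I₁} (h : u = -u) : u = 0 := by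
  have h1 : (2 : 𝕜) • u = 0 := by
    rw [two_smul]
    nth_rewrite 2 [h]
    exact add_neg_cancel u
  exact (smul_eq_zero_iff_right two_ne_zero).mp h1

/-- On homogeneous polynomials the eigenvalues of the Euler operator are natural numbers, so that
no negative number is among them. -/
theorem eq_zero_of_add_euler_eq_zero (J : Finset (I₀ ⊕ Option I₁)) {d : ℕ} {u : Poly 𝕜 I₀ I₁}
    (hu : u ∈ homog 𝕜 I₀ I₁ d) (h : u + euler J u = 0) : u = 0 := by
  have h1 : u ∈ (euler (𝕜 := 𝕜) J).eigenspace (-1) := by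
    rw [Module.End.mem_eigenspace_iff, neg_one_smul]
    exact eq_neg_of_add_eq_zero_right h
  have h2 : u ∈ ⨆ μ : 𝕜, ⨆ _ : μ ≠ -1, (euler (𝕜 := 𝕜) J).eigenspace μ := by
    refine (Submodule.span_le.mpr ?_) hu
    rintro _ ⟨k, l, -, rfl⟩
    classical
    refine Submodule.mem_iSup_of_mem (l.countP (· ∈ J) : 𝕜) (Submodule.mem_iSup_of_mem ?_ ?_)
    · intro h0
      have h3 : ((l.countP (· ∈ J) + 1 : ℕ) : 𝕜) = 0 := by push_cast; rw [h0]; ring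
      exact Nat.succ_ne_zero _ (Nat.cast_eq_zero.mp h3)
    · exact Module.End.mem_eigenspace_iff.mpr (euler_monomial J k l)
  exact Submodule.disjoint_def.mp ((euler (𝕜 := 𝕜) J).eigenspaces_iSupIndep (-1)) u h1 h2

/-- `1 + E` is onto on homogeneous polynomials, where `E` is an Euler operator. -/
theorem exists_add_euler_eq (J : Finset (I₀ ⊕ Option I₁)) {d : ℕ} {u : Poly 𝕜 I₀ I₁}
    (hu : u ∈ homog 𝕜 I₀ I₁ d) : ∃ v ∈ homog 𝕜 I₀ I₁ d, v + euler J v = u := by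
  classical
  induction hu using Submodule.span_induction with
  | mem x hx =>
    obtain ⟨k, l, hd, rfl⟩ := hx
    refine ⟨((l.countP (· ∈ J) : 𝕜) + 1)⁻¹ • (hbar 𝕜 I₀ I₁ ^ k * (l.map (gen 𝕜 I₀ I₁)).prod),
      Submodule.smul_mem _ _ (hd ▸ mem_homog k l), ?_⟩
    rw [map_smul, euler_monomial, ← smul_add]
    nth_rewrite 1 [← one_smul 𝕜 (hbar 𝕜 I₀ I₁ ^ k * (l.map (gen 𝕜 I₀ I₁)).prod)]
    rw [← add_smul, add_comm 1, smul_smul, inv_mul_cancel₀ (Nat.cast_add_one_ne_zero _), one_smul]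
  | zero => exact ⟨0, zero_mem _, by simp⟩
  | add x y _ _ hx hy =>
    obtain ⟨v, hv, rfl⟩ := hx
    obtain ⟨w, hw, rfl⟩ := hy
    exact ⟨v + w, add_mem hv hw, by rw [map_add]; abel⟩
  | smul c x _ hx =>
    obtain ⟨v, hv, rfl⟩ := hx
    exact ⟨c • v, Submodule.smul_mem _ _ hv, by rw [map_smul, smul_add]⟩

/-- The Poincaré lemma, for closed forms with finitely many coefficients `uₐ` of parity `|a|`, in
the directions of any set `I` of variables. With `J` the support, the primitive is
`∑ xᵃ (1 + E)⁻¹ uₐ`, where `E` is the Euler operator of `J`. -/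
theorem exists_primitive {I : Set (I₀ ⊕ Option I₁)} {d : ℕ} (u : I₀ ⊕ Option I₁ → Poly 𝕜 I₀ I₁)
    (hfin : {a | u a ≠ 0}.Finite) (hI : ∀ a, u a ≠ 0 → a ∈ I) (hu : ∀ a, u a ∈ homog 𝕜 I₀ I₁ d)
    (hpar : ∀ a, parityInv 𝕜 I₀ I₁ (u a) = parSign 𝕜 (par a) • u a)
    (hclosed : ∀ a ∈ I, ∀ b ∈ I,
      pd 𝕜 I₀ I₁ a (u b) = swapSign 𝕜 a b • pd 𝕜 I₀ I₁ b (u a)) :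
    ∃ g ∈ homog 𝕜 I₀ I₁ (d + 1), parityInv 𝕜 I₀ I₁ g = g ∧
      g ∈ Ideal.span (Set.range (gen 𝕜 I₀ I₁)) ∧ ∀ a ∈ I, pd 𝕜 I₀ I₁ a g = u a := by
  classical
  set J := hfin.toFinset
  have hJ (a) : a ∉ J → u a = 0 := fun h => by simpa [J] using h
  have hJI (a) (ha : a ∈ J) : a ∈ I := hI a (by simpa [J] using ha)
  choose v hv hvu using fun a => exists_add_euler_eq J (hu a)
  have hvpar (a) : parityInv 𝕜 I₀ I₁ (v a) = parSign 𝕜 (par a) • v a := by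
    refine sub_eq_zero.mp (eq_zero_of_add_euler_eq_zero J
      (sub_mem (parityInv_mem_homog (hv a)) (Submodule.smul_mem _ _ (hv a))) ?_)
    have h1 := congrArg (parityInv 𝕜 I₀ I₁) (hvu a)
    rw [map_add, parityInv_euler, hpar, ← hvu a, smul_add] at h1
    rw [map_sub, map_smul]
    rw [← sub_eq_zero] at h1
    rw [← h1]
    abel
  have hg : ∑ a ∈ J, gen 𝕜 I₀ I₁ a * v a ∈ homog 𝕜 I₀ I₁ (d + 1) :=
    sum_mem fun a _ => add_comm d 1 ▸ homog_mul (gen_mem_homog a) (hv a)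
  refine ⟨∑ a ∈ J, gen 𝕜 I₀ I₁ a * v a, hg, ?_, sum_mem fun a _ => gen_mul_mem_ideal a _, ?_⟩
  · rw [map_sum]
    refine Finset.sum_congr rfl fun a _ => ?_
    rw [map_mul, parityInv_gen, hvpar, smul_mul_smul_comm, ← parSign_add,
      show par a + par a = 0 from CharTwo.add_self_eq_zero _, parSign_zero, one_smul]
  · intro a ha
    by_cases haJ : a ∈ J
    · have hE : euler J (∑ b ∈ J, gen 𝕜 I₀ I₁ b * v b) = ∑ b ∈ J, gen 𝕜 I₀ I₁ b * u b := by
        rw [map_sum]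
        refine Finset.sum_congr rfl fun b hb => ?_
        rw [euler_mul, euler_gen, if_pos hb, ← mul_add, hvu]
      have h1 : pd 𝕜 I₀ I₁ a (∑ b ∈ J, gen 𝕜 I₀ I₁ b * u b) = u a + euler J (u a) := by
        have h2 : ∀ b ∈ J, pd 𝕜 I₀ I₁ a (gen 𝕜 I₀ I₁ b * u b) =
            (if a = b then u a else 0) + gen 𝕜 I₀ I₁ b * pd 𝕜 I₀ I₁ b (u a) := by
          intro b hb
          rw [pd_mul, pd_gen, twist_gen, hclosed a ha b (hJI b hb), smul_mul_smul_comm,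
            swapSign_mul_self, one_smul]
          congr 1
          split_ifs with hab
          · rw [hab, one_mul]
          · rw [zero_mul]
        rw [map_sum, Finset.sum_congr rfl h2, Finset.sum_add_distrib, euler_apply]
        simp [haJ]
      -- With `g = ∑ xᵇ v b` and `E` the Euler operator: `(1 + E) ∂ₐ g = ∂ₐ E g = (1 + E) u a`, and
      -- `1 + E` is injective.
      have h2 := pd_euler_of_mem haJ (∑ b ∈ J, gen 𝕜 I₀ I₁ b * v b)
      rw [hE, h1] at h2
      refine (sub_eq_zero.mp (eq_zero_of_add_euler_eq_zero J
        (sub_mem (hu a) (pd_mem_homog a d _ hg)) ?_)).symm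
      rw [map_sub, sub_add_sub_comm, h2, sub_self]
    · -- Closedness makes the coefficients independent of the variables outside `J`.
      rw [hJ a haJ, map_sum]
      refine Finset.sum_eq_zero fun b hb => ?_
      have hab : a ≠ b := fun h => haJ (h ▸ hb)
      have h1 : pd 𝕜 I₀ I₁ a (u b) = 0 := by
        rw [hclosed a ha b (hJI b hb), hJ a haJ, map_zero, smul_zero]
      have h2 : pd 𝕜 I₀ I₁ a (v b) = 0 := by
        rcases d with _ | d
        · exact pd_of_mem_homog_zero a (hv b)
        · refine eq_zero_of_add_euler_eq_zero J (pd_mem_homog a d _ (hv b)) ?_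
          rw [← pd_euler_of_notMem haJ, ← map_add, hvu, h1]
      rw [pd_mul, pd_gen, if_neg hab, h2, zero_mul, mul_zero, add_zero]

/-- A homogeneous polynomial with vanishing derivatives is a multiple of a power of `ħ`. -/
theorem eq_smul_hbar_pow {d : ℕ} {u : Poly 𝕜 I₀ I₁} (hu : u ∈ homog 𝕜 I₀ I₁ d)
    (h : ∀ a, pd 𝕜 I₀ I₁ a u = 0) : ∃ c : 𝕜, u = c • hbar 𝕜 I₀ I₁ ^ (d / 2) := by
  classical
  -- A monomial with at least one factor `xᵃ` has nonzero Euler eigenvalue as soon as `J` contains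
  -- its variables; only `ħ ^ (d / 2)` remains.
  have key : ∃ (c : 𝕜) (J₀ : Finset (I₀ ⊕ Option I₁)), ∀ J, J₀ ⊆ J →
      u - c • hbar 𝕜 I₀ I₁ ^ (d / 2) ∈
        ⨆ μ : 𝕜, ⨆ _ : μ ≠ 0, (euler (𝕜 := 𝕜) J).eigenspace μ := by
    clear h
    induction hu using Submodule.span_induction with
    | mem x hx =>
      obtain ⟨k, l, rfl, rfl⟩ := hx
      rcases l with _ | ⟨b, l⟩
      · refine ⟨1, ∅, fun J _ => ?_⟩
        simp
      · refine ⟨0, {b}, fun J hJ => ?_⟩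
        rw [zero_smul, sub_zero]
        refine Submodule.mem_iSup_of_mem ((b :: l).countP (· ∈ J) : 𝕜)
          (Submodule.mem_iSup_of_mem ?_ ?_)
        · have hb : b ∈ J := hJ (Finset.mem_singleton_self b)
          rw [List.countP_cons_of_pos (by simpa using hb)]
          exact Nat.cast_ne_zero.mpr (Nat.succ_ne_zero _)
        · exact Module.End.mem_eigenspace_iff.mpr (euler_monomial J k _)
    | zero => exact ⟨0, ∅, fun J _ => by simp⟩
    | add x y _ _ hx hy =>
      obtain ⟨c, J₁, h₁⟩ := hx
      obtain ⟨e, J₂, h₂⟩ := hy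
      refine ⟨c + e, J₁ ∪ J₂, fun J hJ => ?_⟩
      rw [add_smul, add_sub_add_comm]
      exact add_mem (h₁ J (Finset.union_subset_left hJ)) (h₂ J (Finset.union_subset_right hJ))
    | smul e x _ hx =>
      obtain ⟨c, J₁, h₁⟩ := hx
      refine ⟨e * c, J₁, fun J hJ => ?_⟩
      rw [mul_smul, ← smul_sub]
      exact Submodule.smul_mem _ _ (h₁ J hJ)
  obtain ⟨c, J, hJ⟩ := key
  have hpow : euler J (hbar 𝕜 I₀ I₁ ^ (d / 2)) = 0 := by
    have := euler_hbar_pow_mul (𝕜 := 𝕜) J (d / 2) 1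
    rw [mul_one] at this
    rw [this]
    simp [euler_apply, pd_one]
  refine ⟨c, sub_eq_zero.mp (Submodule.disjoint_def.mp
    ((euler (𝕜 := 𝕜) J).eigenspaces_iSupIndep 0) _ ?_ (hJ J subset_rfl))⟩
  rw [Module.End.mem_eigenspace_iff, map_sub, map_smul, hpow, euler_apply]
  simp [h]

/-- An even polynomial without constant term whose derivatives in all directions but one, odd,
direction vanish is zero. -/
theorem eq_zero_of_pd_eq_zero {d : ℕ} {u : Poly 𝕜 I₀ I₁} (hu : u ∈ homog 𝕜 I₀ I₁ d)
    (heven : parityInv 𝕜 I₀ I₁ u = u) (hconst : u ∈ Ideal.span (Set.range (gen 𝕜 I₀ I₁)))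
    (o : Option I₁) (h : ∀ a, a ≠ Sum.inr o → pd 𝕜 I₀ I₁ a u = 0) : u = 0 := by
  have hinv (k : ℕ) (c : 𝕜) : parityInv 𝕜 I₀ I₁ (c • hbar 𝕜 I₀ I₁ ^ k) =
      c • hbar 𝕜 I₀ I₁ ^ k := by rw [map_smul, map_pow, parityInv_hbar]
  -- `∂ₒ u` is odd, and all its derivatives vanish, so that it is a polynomial in `ħ`, thus even.
  have h0 : pd 𝕜 I₀ I₁ (Sum.inr o) u = 0 := by
    rcases d with _ | d
    · exact pd_of_mem_homog_zero _ hu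
    obtain ⟨c, hc⟩ := eq_smul_hbar_pow (pd_mem_homog (Sum.inr o) d u hu) (by
      intro a
      by_cases ha : a = Sum.inr o
      · subst ha
        have h1 := pd_pd_comm (Sum.inr o) (Sum.inr o) u
        have h2 : swapSign 𝕜 (Sum.inr o : I₀ ⊕ Option I₁) (Sum.inr o) = -1 := by
          simp [swapSign, par, ZMod.val_one]
        rw [h2, neg_one_smul] at h1
        exact eq_zero_of_eq_neg h1
      · rw [pd_pd_comm, h a ha, map_zero, smul_zero])
    have h1 := parityInv_pd (Sum.inr o) u
    rw [heven, par, parSign_one, neg_one_smul, hc, hinv] at h1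
    rw [hc]
    exact eq_zero_of_eq_neg h1
  obtain ⟨c, hc⟩ := eq_smul_hbar_pow hu fun a => by
    by_cases ha : a = Sum.inr o
    · rw [ha, h0]
    · exact h a ha
  have h1 := augment_eq_zero hconst
  rw [hc, map_smul, map_pow, augment_hbar, one_pow, smul_eq_mul, mul_one] at h1
  rw [hc, h1, zero_smul]

end Poincare

/-! ### Orders and parities of series and operators -/

section Order

variable {𝕜 : Type*} [Field 𝕜] {I₀ I₁ : Type*} {m n r s : ℕ} {f g : Series 𝕜 I₀ I₁}
  {D E : Module.End 𝕜 (Series 𝕜 I₀ I₁)}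

theorem OrderGE.mono (hf : OrderGE n f) (h : m ≤ n) : OrderGE m f :=
  fun d hd => hf d (hd.trans_le h)

theorem orderGE_zero_left (f : Series 𝕜 I₀ I₁) : OrderGE 0 f := fun d hd => absurd hd d.not_lt_zero

theorem orderGE_zero_right (n : ℕ) : OrderGE n (0 : Series 𝕜 I₀ I₁) := fun _ _ => rfl

theorem OrderGE.add (hf : OrderGE n f) (hg : OrderGE n g) : OrderGE n (f + g) := fun d hd => by
  rw [comp_add, hf d hd, hg d hd, add_zero]

theorem OrderGE.sub (hf : OrderGE n f) (hg : OrderGE n g) : OrderGE n (f - g) := fun d hd => by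
  rw [comp_sub, hf d hd, hg d hd, sub_zero]

theorem OrderGE.neg (hf : OrderGE n f) : OrderGE n (-f) := by
  rw [← zero_sub]
  exact (orderGE_zero_right n).sub hf

theorem OrderGE.smul (c : 𝕜) (hf : OrderGE n f) : OrderGE n (c • f) := fun d hd => by
  rw [comp_smul, hf d hd, smul_zero]

theorem OrderGE.sum {ι : Type*} {s : Finset ι} {f : ι → Series 𝕜 I₀ I₁}
    (h : ∀ i ∈ s, OrderGE n (f i)) : OrderGE n (∑ i ∈ s, f i) :=
  Finset.sum_induction _ _ (fun _ _ => OrderGE.add) (orderGE_zero_right n) h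

theorem OpOrderGE.add (hD : OpOrderGE r D) (hE : OpOrderGE r E) : OpOrderGE r (D + E) :=
  fun n f hf => (hD n f hf).add (hE n f hf)

theorem OpOrderGE.smul (c : 𝕜) (hD : OpOrderGE r D) : OpOrderGE r (c • D) :=
  fun n f hf => (hD n f hf).smul c

theorem OpOrderGE.mono (hD : OpOrderGE r D) (h : s ≤ r) : OpOrderGE s D :=
  fun n f hf => (hD n f hf).mono (Nat.add_le_add_left h n)

variable (𝕜 I₀ I₁) in
/-- `comp d` as a linear map. -/
def compLin (d : ℕ) : Series 𝕜 I₀ I₁ →ₗ[𝕜] Poly 𝕜 I₀ I₁ where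
  toFun := comp d
  map_add' := comp_add d
  map_smul' c f := comp_smul d c f

theorem comp_sum {ι : Type*} (d : ℕ) (s : Finset ι) (f : ι → Series 𝕜 I₀ I₁) :
    comp d (∑ i ∈ s, f i) = ∑ i ∈ s, comp d (f i) := map_sum (compLin 𝕜 I₀ I₁ d) f s

theorem comp_neg (d : ℕ) (f : Series 𝕜 I₀ I₁) : comp d (-f) = -comp d f :=
  map_neg (compLin 𝕜 I₀ I₁ d) f

theorem mulOp_apply (f g : Series 𝕜 I₀ I₁) : mulOp f g = f * g := rfl

theorem comp_one (d : ℕ) : comp d (1 : Series 𝕜 I₀ I₁) = if d = 0 then 1 else 0 :=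
  PowerSeries.coeff_one d

theorem comp_ofHomog (r : ℕ) (u : Poly 𝕜 I₀ I₁) (hu) (d : ℕ) :
    comp d (ofHomog r u hu) = if d = r then u else 0 := comp_ofComp _ _ _

theorem comp_ofHomog_mul (r : ℕ) (u : Poly 𝕜 I₀ I₁) (hu) (f : Series 𝕜 I₀ I₁) (d : ℕ) :
    comp (d + r) (ofHomog r u hu * f) = u * comp d f := by
  rw [comp_mul, Finset.sum_eq_single (r, d)]
  · rw [comp_ofHomog, if_pos rfl]
  · rintro ⟨i, j⟩ hij hne
    rw [Finset.HasAntidiagonal.mem_antidiagonal] at hij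
    have hi : i ≠ r := by
      rintro rfl
      exact hne (Prod.ext rfl (by simp at hij ⊢; omega))
    rw [comp_ofHomog, if_neg hi, zero_mul]
  · intro h
    exact absurd (Finset.HasAntidiagonal.mem_antidiagonal.mpr (add_comm r d)) h

theorem comp_pdOp (a : I₀ ⊕ Option I₁) (d : ℕ) (f : Series 𝕜 I₀ I₁) :
    comp d (pdOp a f) = pd 𝕜 I₀ I₁ a (comp (d + 1) f) :=
  comp_ofComp _ (fun d => pd_mem_homog a d _ (comp_mem _ f)) _

theorem comp_divHbarOp (d : ℕ) (f : Series 𝕜 I₀ I₁) :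
    comp d (divHbarOp f) = divHbar 𝕜 I₀ I₁ (comp (d + 2) f) :=
  comp_ofComp _ (fun d => divHbar_mem_homog d _ (comp_mem _ f)) _

theorem comp_hbarOp (d : ℕ) (f : Series 𝕜 I₀ I₁) :
    comp (d + 2) (hbarOp f) = hbar 𝕜 I₀ I₁ * comp d f := comp_ofHomog_mul _ _ _ _ _

theorem divHbarOp_hbarOp (f : Series 𝕜 I₀ I₁) : divHbarOp (hbarOp f) = f := by
  ext d
  rw [comp_divHbarOp, comp_hbarOp, divHbar_hbar_mul]

theorem OrderGE.divHbarOp (hf : OrderGE (n + 2) f) : OrderGE n (divHbarOp f) := fun d hd => by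
  rw [comp_divHbarOp, hf (d + 2) (by omega), map_zero]

theorem OrderGE.hbarOp (hf : OrderGE n f) : OrderGE (n + 2) (hbarOp f) :=
  mulOp_orderGE 2 _ (ofHomog_orderGE _ _ _) n f hf

theorem OrderGE.pdOp (a : I₀ ⊕ Option I₁) (hf : OrderGE (n + 1) f) : OrderGE n (pdOp a f) :=
  fun d hd => by rw [comp_pdOp, hf (d + 1) (by omega), map_zero]

/-- Even series are central. -/
theorem mul_comm_of_even (hf : HasParity 0 f) (g : Series 𝕜 I₀ I₁) : f * g = g * f := by
  refine series_ext fun d => ?_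
  rw [comp_mul, comp_mul]
  refine Finset.sum_equiv (Equiv.prodComm ℕ ℕ) (by simp [add_comm]) ?_
  rintro ⟨i, j⟩ _
  exact (commute_of_even (by simpa using hf i) (comp_mem j g)).eq

/-- `ħ` is central in the algebra of series. -/
theorem hbarOp_mul_comm (f g : Series 𝕜 I₀ I₁) : f * hbarOp g = hbarOp (f * g) := by
  have h : ofHomog 2 (hbar 𝕜 I₀ I₁) hbar_mem_homog * f =
      f * ofHomog 2 (hbar 𝕜 I₀ I₁) hbar_mem_homog := by
    refine mul_comm_of_even (fun d => ?_) f
    rw [comp_ofHomog]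
    split_ifs <;> simp [parityInv_hbar]
  change f * (_ * g) = _ * (f * g)
  rw [← mul_assoc, ← h, mul_assoc]

/-- The Leibniz rule for the product of an even series and an arbitrary one. -/
theorem pdOp_mul_of_even (hf : HasParity 0 f) (a : I₀ ⊕ Option I₁) (g : Series 𝕜 I₀ I₁) :
    pdOp a (f * g) = pdOp a f * g + f * pdOp a g := by
  refine series_ext fun d => ?_
  have h (i : ℕ) : twist a (comp i f) = comp i f := by
    rcases a with a | a
    · rfl
    · simpa [twist] using hf i
  rw [comp_pdOp, comp_add, comp_mul, comp_mul, comp_mul, map_sum]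
  simp only [pd_mul, h, comp_pdOp, Finset.sum_add_distrib]
  congr 1
  · rw [Finset.Nat.sum_antidiagonal_succ, pd_of_mem_homog_zero a (comp_mem 0 f), zero_mul, zero_add]
  · rw [Finset.Nat.sum_antidiagonal_succ', pd_of_mem_homog_zero a (comp_mem 0 g), mul_zero]
    exact zero_add _

theorem hasParity_iff {p : ZMod 2} :
    HasParity p f ↔ ∀ d, parityInv 𝕜 I₀ I₁ (comp d f) = parSign 𝕜 p • comp d f := Iff.rfl

theorem HasParity.add {p : ZMod 2} (hf : HasParity p f) (hg : HasParity p g) :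
    HasParity p (f + g) := fun d => by rw [comp_add, map_add, hf, hg, smul_add]

theorem HasParity.neg {p : ZMod 2} (hf : HasParity p f) : HasParity p (-f) := fun d => by
  rw [comp_neg, map_neg, hf, smul_neg]

theorem HasParity.sub {p : ZMod 2} (hf : HasParity p f) (hg : HasParity p g) :
    HasParity p (f - g) := sub_eq_add_neg f g ▸ hf.add hg.neg

theorem HasParity.mul {p q : ZMod 2} (hf : HasParity p f) (hg : HasParity q g) :
    HasParity (p + q) (f * g) := by
  rw [hasParity_iff] at *
  intro d
  rw [comp_mul, map_sum, Finset.smul_sum]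
  refine Finset.sum_congr rfl fun x _ => ?_
  rw [map_mul, hf, hg, smul_mul_smul_comm, parSign_add]

theorem HasParity.divHbarOp {p : ZMod 2} (hf : HasParity p f) : HasParity p (divHbarOp f) :=
  fun d => by rw [comp_divHbarOp, parityInv_divHbar, hf, map_smul]

theorem hasParity_one : HasParity 0 (1 : Series 𝕜 I₀ I₁) := fun d => by
  rw [comp_one]
  split_ifs <;> simp

end Order

/-! ### The derivation `-(1/ħ)[F, ·]` of the completed Weyl algebra -/

section Bracket

variable {𝕜 : Type*} [Field 𝕜] {I₀ I₁ : Type*} {m n r s : ℕ} {F f g : Series 𝕜 I₀ I₁}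
  {D E T U : Module.End 𝕜 (Series 𝕜 I₀ I₁)}

theorem adOp_apply (F : Series 𝕜 I₀ I₁) (D : Module.End 𝕜 (Series 𝕜 I₀ I₁))
    (f : Series 𝕜 I₀ I₁) : adOp F D f = -divHbarOp (F * D f - D (F * f)) := rfl

theorem adOp_eq_of_hbarOp_mul (h : hbarOp * E = D * mulOp F - mulOp F * D) :
    adOp F D = E := by
  ext1 f
  have h1 : hbarOp (E f) = D (F * f) - F * D f := LinearMap.congr_fun h f
  rw [adOp_apply, ← map_neg, neg_sub, ← h1, divHbarOp_hbarOp]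

/-- If `F` has order at least `s + 2` then `-(1/ħ)[F, ·]` raises orders by `s`. -/
theorem OpOrderGE.adOp (hD : OpOrderGE r D) (hF : OrderGE (s + 2) F) :
    OpOrderGE (r + s) (adOp F D) := by
  intro n f hf
  have h1 : OrderGE (n + (r + s) + 2) (F * D f) :=
    (mulOp_orderGE _ F hF _ _ (hD n f hf)).mono (by omega)
  have h2 : OrderGE (n + (r + s) + 2) (D (F * f)) :=
    (hD _ _ (mulOp_orderGE _ F hF n f hf)).mono (by omega)
  exact (h1.sub h2).divHbarOp.neg

theorem OpOrderGE.adOp_iterate (hD : OpOrderGE r D) (hF : OrderGE 3 F) (n : ℕ) :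
    OpOrderGE (r + n) ((SuperAiry.adOp F)^[n] D) := by
  induction n with
  | zero => exact hD
  | succ n ih =>
    rw [Function.iterate_succ_apply']
    exact ih.adOp hF

theorem weyl_orderGE (hT : T ∈ Weyl 𝕜 I₀ I₁) : OpOrderGE 0 T := by
  intro n f hf
  obtain ⟨D, hD, h⟩ := hT {f} n
  rw [← sub_add_cancel (T f) (D f)]
  exact (h f (Finset.mem_singleton_self f)).add (weylGenerated_orderGE D hD n f hf)

theorem hbarOp_pdOp_orderGE (a : I₀ ⊕ Option I₁) :
    OpOrderGE 1 (hbarOp * pdOp a : Module.End 𝕜 (Series 𝕜 I₀ I₁)) := by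
  intro n f hf
  rcases n with _ | n
  · exact (orderGE_zero_left (pdOp a f)).hbarOp.mono (by omega)
  · exact (OrderGE.pdOp a hf).hbarOp

theorem weylGenerated_hbarOp_comm (hD : D ∈ weylGenerated 𝕜 I₀ I₁) (f : Series 𝕜 I₀ I₁) :
    D (hbarOp f) = hbarOp (D f) := by
  induction hD using Algebra.adjoin_induction generalizing f with
  | mem D hD =>
    rcases hD with (rfl | ⟨a, rfl⟩) | ⟨a, rfl⟩
    · rfl
    · exact hbarOp_mul_comm _ _
    · have h : pdOp a (hbarOp f) = hbarOp (pdOp a f) := by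
        refine series_ext fun d => ?_
        rw [comp_pdOp]
        rcases d with _ | _ | d
        · rw [OrderGE.hbarOp (orderGE_zero_left f) (0 + 1) (by omega), map_zero,
            OrderGE.hbarOp (orderGE_zero_left _) 0 (by omega)]
        · rw [comp_hbarOp, pd_hbar_mul, pd_of_mem_homog_zero a (comp_mem 0 f), mul_zero,
            OrderGE.hbarOp (orderGE_zero_left _) _ (by omega)]
        · rw [show d + 1 + 1 + 1 = d + 1 + 2 from rfl, comp_hbarOp, pd_hbar_mul, ← comp_pdOp,
            ← comp_hbarOp]
      exact congrArg hbarOp h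
  | algebraMap c => exact (map_smul hbarOp c f).symm
  | add D E _ _ hD hE => rw [LinearMap.add_apply, hD, hE, LinearMap.add_apply, map_add]
  | mul D E _ _ hD hE => rw [Module.End.mul_apply, hE, hD, Module.End.mul_apply]

theorem eq_of_forall_orderGE (h : ∀ n, OrderGE n (f - g)) : f = g := by
  refine series_ext fun d => sub_eq_zero.mp ?_
  rw [← comp_sub]
  exact h (d + 1) d d.lt_succ_self

theorem weyl_hbarOp_comm (hT : T ∈ Weyl 𝕜 I₀ I₁) (f : Series 𝕜 I₀ I₁) :
    T (hbarOp f) = hbarOp (T f) := by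
  classical
  refine eq_of_forall_orderGE fun n => ?_
  obtain ⟨D, hD, h⟩ := hT {f, hbarOp f} n
  have h1 : T (hbarOp f) - hbarOp (T f) =
      (T (hbarOp f) - D (hbarOp f)) - hbarOp (T f - D f) := by
    rw [map_sub, weylGenerated_hbarOp_comm hD]
    abel
  rw [h1]
  exact (h _ (by simp)).sub ((h f (by simp)).hbarOp.mono (by omega))

theorem weyl_hbarOp_mul_comm (hT : T ∈ Weyl 𝕜 I₀ I₁) : T * hbarOp = hbarOp * T :=
  LinearMap.ext fun f => weyl_hbarOp_comm hT f

theorem ofHomog_mul_ofHomog {p q : ℕ} (u v : Poly 𝕜 I₀ I₁) (hu : u ∈ homog 𝕜 I₀ I₁ p)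
    (hv : v ∈ homog 𝕜 I₀ I₁ q) :
    ofHomog p u hu * ofHomog q v hv = ofHomog (p + q) (u * v) (homog_mul hu hv) := by
  refine series_ext fun d => ?_
  by_cases hd : p ≤ d
  · obtain ⟨e, rfl⟩ := Nat.exists_eq_add_of_le' hd
    rw [comp_ofHomog_mul, comp_ofHomog, comp_ofHomog]
    by_cases he : e = q
    · rw [if_pos he, if_pos (by omega)]
    · rw [if_neg he, if_neg (by omega), mul_zero]
  · rw [comp_ofHomog, if_neg (by omega)]
    exact mulOp_orderGE p _ (ofHomog_orderGE _ _ _) 0 _ (orderGE_zero_left _) d (by omega)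

theorem mulOp_ofHomog_mem {r : ℕ} {u : Poly 𝕜 I₀ I₁} (hu : u ∈ homog 𝕜 I₀ I₁ r) :
    mulOp (ofHomog r u hu) ∈ weylGenerated 𝕜 I₀ I₁ := by
  have hmul (f g : Series 𝕜 I₀ I₁) : mulOp (f * g) = mulOp f * mulOp g :=
    LinearMap.ext fun h => mul_assoc f g h
  have hone (h) : mulOp (ofHomog 0 1 h) = (1 : Module.End 𝕜 (Series 𝕜 I₀ I₁)) := by
    have h1 : ofHomog 0 1 h = (1 : Series 𝕜 I₀ I₁) := series_ext fun d => by
      rw [comp_ofHomog, comp_one]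
    rw [h1]
    exact LinearMap.ext fun f => one_mul f
  have hcast {p q : ℕ} {v w : Poly 𝕜 I₀ I₁} (hv : v ∈ homog 𝕜 I₀ I₁ p)
      (hw : w ∈ homog 𝕜 I₀ I₁ q) (hpq : p = q) (hvw : v = w)
      (h : mulOp (ofHomog p v hv) ∈ weylGenerated 𝕜 I₀ I₁) :
      mulOp (ofHomog q w hw) ∈ weylGenerated 𝕜 I₀ I₁ := by
    subst hpq hvw
    exact h
  have hlist (l : List (I₀ ⊕ Option I₁)) (h : (l.map (gen 𝕜 I₀ I₁)).prod ∈
      homog 𝕜 I₀ I₁ l.length) : mulOp (ofHomog _ _ h) ∈ weylGenerated 𝕜 I₀ I₁ := by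
    induction l with
    | nil => exact (hone h).symm ▸ one_mem _
    | cons b l ih =>
      have hl : (l.map (gen 𝕜 I₀ I₁)).prod ∈ homog 𝕜 I₀ I₁ l.length := by
        simpa using mem_homog (𝕜 := 𝕜) 0 l
      refine hcast (homog_mul (gen_mem_homog b) hl) h (by simp [add_comm]) (by simp) ?_
      rw [← ofHomog_mul_ofHomog _ _ (gen_mem_homog b) hl, hmul]
      exact mul_mem (Algebra.subset_adjoin (Or.inl (Or.inr ⟨b, rfl⟩))) (ih hl)
  have hmon (k : ℕ) (l : List (I₀ ⊕ Option I₁)) (h : hbar 𝕜 I₀ I₁ ^ k *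
      (l.map (gen 𝕜 I₀ I₁)).prod ∈ homog 𝕜 I₀ I₁ (2 * k + l.length)) :
      mulOp (ofHomog _ _ h) ∈ weylGenerated 𝕜 I₀ I₁ := by
    induction k with
    | zero =>
      have hl : (l.map (gen 𝕜 I₀ I₁)).prod ∈ homog 𝕜 I₀ I₁ l.length := by
        simpa using mem_homog (𝕜 := 𝕜) 0 l
      exact hcast hl h (by simp) (by simp) (hlist l hl)
    | succ k ih =>
      refine hcast (homog_mul hbar_mem_homog (mem_homog k l)) h (by ring)
        (by rw [pow_succ', mul_assoc]) ?_
      rw [← ofHomog_mul_ofHomog _ _ hbar_mem_homog (mem_homog k l), hmul]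
      exact mul_mem (Algebra.subset_adjoin (Or.inl (Or.inl rfl))) (ih _)
  have hadd {x y : Poly 𝕜 I₀ I₁} (hx : x ∈ homog 𝕜 I₀ I₁ r) (hy : y ∈ homog 𝕜 I₀ I₁ r) :
      mulOp (ofHomog r (x + y) (add_mem hx hy)) =
        mulOp (ofHomog r x hx) + mulOp (ofHomog r y hy) := by
    have h1 : ofHomog r (x + y) (add_mem hx hy) = ofHomog r x hx + ofHomog r y hy :=
      series_ext fun d => by
        simp only [comp_ofHomog, comp_add]
        split_ifs <;> simp
    rw [h1]
    exact LinearMap.ext fun f => add_mul _ _ f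
  have hsmul (c : 𝕜) {x : Poly 𝕜 I₀ I₁} (hx : x ∈ homog 𝕜 I₀ I₁ r) :
      mulOp (ofHomog r (c • x) (Submodule.smul_mem _ c hx)) = c • mulOp (ofHomog r x hx) := by
    have h1 : ofHomog r (c • x) (Submodule.smul_mem _ c hx) = c • ofHomog r x hx :=
      series_ext fun d => by
        simp only [comp_ofHomog, comp_smul]
        split_ifs <;> simp
    rw [h1]
    exact LinearMap.ext fun f => smul_mul_assoc c _ f
  have hzero : mulOp (ofHomog r 0 (zero_mem _)) = (0 : Module.End 𝕜 (Series 𝕜 I₀ I₁)) := by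
    have h1 : ofHomog r 0 (zero_mem _) = (0 : Series 𝕜 I₀ I₁) := series_ext fun d => by
      rw [comp_ofHomog, ite_self, comp_zero]
    rw [h1]
    exact LinearMap.ext fun f => zero_mul f
  induction hu using Submodule.span_induction with
  | mem x hx =>
    obtain ⟨k, l, rfl, rfl⟩ := hx
    exact hmon k l _
  | zero =>
    refine (congrArg (· ∈ weylGenerated 𝕜 I₀ I₁) hzero).mpr ?_
    exact zero_mem _
  | add x y hx hy ihx ihy =>
    exact (congrArg (· ∈ weylGenerated 𝕜 I₀ I₁) (hadd hx hy)).mpr (add_mem ihx ihy)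
  | smul c x hx ih =>
    exact (congrArg (· ∈ weylGenerated 𝕜 I₀ I₁) (hsmul c hx)).mpr (Subalgebra.smul_mem _ ih c)

/-- Multiplication by a series is the limit of the multiplications by its partial sums. -/
theorem mulOp_mem_weyl (g : Series 𝕜 I₀ I₁) : mulOp g ∈ Weyl 𝕜 I₀ I₁ := by
  intro s n
  refine ⟨∑ k ∈ Finset.range n, mulOp (ofHomog k (comp k g) (comp_mem k g)),
    sum_mem fun k _ => mulOp_ofHomog_mem _, fun f _ => ?_⟩
  have h : OrderGE n (g - ∑ k ∈ Finset.range n, ofHomog k (comp k g) (comp_mem k g)) := by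
    intro d hd
    rw [comp_sub, comp_sum, Finset.sum_eq_single d]
    · rw [comp_ofHomog, if_pos rfl, sub_self]
    · intro k _ hk
      rw [comp_ofHomog, if_neg hk.symm]
    · intro h
      exact absurd (Finset.mem_range.mpr hd) h
  have h1 := mulOp_orderGE n _ h 0 f (orderGE_zero_left f)
  rw [mulOp_apply, sub_mul, Finset.sum_mul, zero_add] at h1
  rw [LinearMap.sum_apply]
  exact h1

/-- `[F, ·]` maps the completed Weyl algebra to `ħ` times itself. On the generators this is
`[F, ħ∂ₐ] = -ħ ∂ₐF`. -/
theorem adOp_spec (hF : HasParity 0 F) (hT : T ∈ Weyl 𝕜 I₀ I₁) :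
    adOp F T ∈ Weyl 𝕜 I₀ I₁ ∧ hbarOp * adOp F T = T * mulOp F - mulOp F * T := by
  classical
  -- The claim for the generated algebra; the closure is then reached by approximation. Division
  -- by `ħ` lowers degrees by two, so the approximation must be two degrees better than required.
  have key (D : Module.End 𝕜 (Series 𝕜 I₀ I₁)) (hD : D ∈ weylGenerated 𝕜 I₀ I₁) :
      ∃ E ∈ Weyl 𝕜 I₀ I₁, hbarOp * E = D * mulOp F - mulOp F * D := by
    have hx (g : Series 𝕜 I₀ I₁) : mulOp F * mulOp g = mulOp g * mulOp F :=
      LinearMap.ext fun f => by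
        change F * (g * f) = g * (F * f)
        rw [← mul_assoc, mul_comm_of_even hF, mul_assoc]
    induction hD using Algebra.adjoin_induction with
    | mem D hD =>
      rcases hD with (rfl | ⟨a, rfl⟩) | ⟨a, rfl⟩
      · exact ⟨0, zero_mem _, by simp [hbarOp, hx]⟩
      · exact ⟨0, zero_mem _, by simp [xOp, hx]⟩
      · refine ⟨mulOp (pdOp a F), mulOp_mem_weyl _, LinearMap.ext fun f => ?_⟩
        change hbarOp (pdOp a F * f) = hbarOp (pdOp a (F * f)) - F * hbarOp (pdOp a f)
        rw [pdOp_mul_of_even hF, hbarOp_mul_comm, map_add]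
        abel
    | algebraMap c =>
      refine ⟨0, zero_mem _, ?_⟩
      rw [← Algebra.commutes c (mulOp F), sub_self, mul_zero]
    | add D E _ _ hD hE =>
      obtain ⟨D', hD', h1⟩ := hD
      obtain ⟨E', hE', h2⟩ := hE
      exact ⟨D' + E', add_mem hD' hE', by rw [mul_add, h1, h2, mul_add, add_mul]; abel⟩
    | mul D E hD0 hE0 hD hE =>
      obtain ⟨D', hD', h1⟩ := hD
      obtain ⟨E', hE', h2⟩ := hE
      refine ⟨D' * E + D * E', add_mem (mul_mem hD' (weylGenerated_le hE0))
        (mul_mem (weylGenerated_le hD0) hE'), ?_⟩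
      rw [mul_add, ← mul_assoc, ← mul_assoc, h1, ← weyl_hbarOp_mul_comm (weylGenerated_le hD0),
        mul_assoc D, h2, sub_mul, mul_sub]
      simp only [mul_assoc]
      abel
  constructor
  · intro s n
    obtain ⟨D, hD, h⟩ := hT (s ∪ s.image fun f => F * f) (n + 2)
    obtain ⟨E, hE, hDE⟩ := key D hD
    obtain ⟨E', hE', hs⟩ := hE s n
    refine ⟨E', hE', fun f hf => ?_⟩
    have h1 : adOp F T f - adOp F D f =
        -divHbarOp (F * (T f - D f) - (T (F * f) - D (F * f))) := by
      rw [adOp_apply, adOp_apply, mul_sub, neg_sub_neg, ← map_sub, ← map_neg]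
      congr 1
      abel
    have h2 : OrderGE n (adOp F T f - adOp F D f) := by
      rw [h1]
      refine (((mulOp_orderGE 0 F (orderGE_zero_left F) _ _ (h f ?_)).sub (h (F * f) ?_))
        |>.divHbarOp).neg
      · exact Finset.mem_union_left _ hf
      · exact Finset.mem_union_right _ (Finset.mem_image_of_mem _ hf)
    rw [adOp_eq_of_hbarOp_mul hDE] at h2
    rw [← sub_add_sub_cancel _ (E f)]
    exact h2.add (hs f hf)
  · refine LinearMap.ext fun f => eq_of_forall_orderGE fun n => ?_
    obtain ⟨D, hD, h⟩ := hT {f, F * f} (n + 2)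
    obtain ⟨E, hE, hDE⟩ := key D hD
    have h0 := LinearMap.congr_fun hDE f
    rw [← adOp_eq_of_hbarOp_mul hDE] at h0
    change hbarOp (adOp F D f) = D (F * f) - F * D f at h0
    have h1 : OrderGE (n + 2) (F * (T f - D f) - (T (F * f) - D (F * f))) :=
      (mulOp_orderGE 0 F (orderGE_zero_left F) _ _ (h f (by simp))).sub (h (F * f) (by simp))
    have h2 : hbarOp (adOp F T f) - (T (F * f) - F * T f) =
        (F * (T f - D f) - (T (F * f) - D (F * f))) -
          hbarOp (divHbarOp (F * (T f - D f) - (T (F * f) - D (F * f)))) := by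
      have h3 : adOp F T f = adOp F D f -
          divHbarOp (F * (T f - D f) - (T (F * f) - D (F * f))) := by
        rw [adOp_apply, adOp_apply, mul_sub, ← map_neg, ← map_neg, ← map_sub]
        congr 1
        abel
      rw [h3, map_sub, h0, mul_sub]
      abel
    change OrderGE n (hbarOp (adOp F T f) - (T (F * f) - F * T f))
    rw [h2]
    exact (h1.mono (by omega)).sub (h1.divHbarOp.hbarOp.mono (by omega))

/-- `-(1/ħ)[F, ·]` is a derivation of the completed Weyl algebra. -/
theorem adOp_mul (hF : HasParity 0 F) (hT : T ∈ Weyl 𝕜 I₀ I₁) (hU : U ∈ Weyl 𝕜 I₀ I₁) :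
    adOp F (T * U) = adOp F T * U + T * adOp F U := by
  apply adOp_eq_of_hbarOp_mul
  rw [mul_add, ← mul_assoc, ← mul_assoc, (adOp_spec hF hT).2, ← weyl_hbarOp_mul_comm hT,
    mul_assoc T, (adOp_spec hF hU).2, sub_mul, mul_sub]
  simp only [mul_assoc]
  abel

/-- `-(1/ħ)[F, ·]` as a linear map. -/
def adLin (F : Series 𝕜 I₀ I₁) : Module.End 𝕜 (Module.End 𝕜 (Series 𝕜 I₀ I₁)) where
  toFun := adOp F
  map_add' D E := by
    simp only [adOp, mul_add, add_mul, mul_sub]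
    abel
  map_smul' c D := by
    simp only [adOp, mul_smul_comm, smul_mul_assoc, ← smul_sub, smul_neg, RingHom.id_apply]

theorem adLin_pow_apply (F : Series 𝕜 I₀ I₁) (n : ℕ) (D : Module.End 𝕜 (Series 𝕜 I₀ I₁)) :
    (adLin F ^ n) D = (adOp F)^[n] D := Module.End.pow_apply _ _ _

theorem adOp_iterate_mem (hF : HasParity 0 F) (hT : T ∈ Weyl 𝕜 I₀ I₁) (n : ℕ) :
    (adOp F)^[n] T ∈ Weyl 𝕜 I₀ I₁ := by
  induction n with
  | zero => exact hT
  | succ n ih =>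
    rw [Function.iterate_succ_apply']
    exact (adOp_spec hF ih).1

theorem OpHasParity.adOp {p : ZMod 2} (hD : OpHasParity p D) (hF : HasParity 0 F) :
    OpHasParity p (adOp F D) := by
  intro q f hf
  have h1 : HasParity (p + q) (F * D f) := by simpa using hF.mul (hD q f hf)
  have h2 : HasParity (p + q) (D (F * f)) := hD q _ (by simpa using hF.mul hf)
  exact (h1.sub h2).divHbarOp.neg

end Bracket

/-! ### Conjugation by the exponential of `F/ħ` -/

section Psi

variable {𝕜 : Type*} [Field 𝕜] {I₀ I₁ : Type*} {m n r : ℕ} {F H f g : Series 𝕜 I₀ I₁}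
  {D E T U : Module.End 𝕜 (Series 𝕜 I₀ I₁)}

/-- The `n`-th term `(1/n!) (-(1/ħ)[F, ·])ⁿ(D)` of `ψ_F(D)`. -/
def psiTerm (F : Series 𝕜 I₀ I₁) (D : Module.End 𝕜 (Series 𝕜 I₀ I₁)) (n : ℕ) :
    Module.End 𝕜 (Series 𝕜 I₀ I₁) := (n.factorial : 𝕜)⁻¹ • (adOp F)^[n] D

theorem psiTerm_zero (F : Series 𝕜 I₀ I₁) (D : Module.End 𝕜 (Series 𝕜 I₀ I₁)) :
    psiTerm F D 0 = D := by simp [psiTerm]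

theorem psiTerm_orderGE (hF : OrderGE 3 F) (hD : OpOrderGE r D) (n : ℕ) :
    OpOrderGE (r + n) (psiTerm F D n) := (hD.adOp_iterate hF n).smul _

theorem comp_psi (F : Series 𝕜 I₀ I₁) (D : Module.End 𝕜 (Series 𝕜 I₀ I₁)) (f : Series 𝕜 I₀ I₁)
    (d : ℕ) : comp d (psi F D f) = ∑ n ∈ Finset.range (d + 1), comp d (psiTerm F D n f) := by
  unfold psi
  exact comp_ofComp _ (fun d => sum_mem fun n _ =>
    Submodule.smul_mem _ (n.factorial : 𝕜)⁻¹ (comp_mem d (((adOp F)^[n] D) f))) d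

/-- Modulo series of order at least `N`, the first `N` terms of `ψ_F(D)` suffice. -/
theorem psi_sub_sum_orderGE (hF : OrderGE 3 F) (hD : OpOrderGE 0 D) (f : Series 𝕜 I₀ I₁)
    (N : ℕ) : OrderGE N (psi F D f - ∑ n ∈ Finset.range N, psiTerm F D n f) := by
  intro d hd
  rw [comp_sub, comp_sum, comp_psi, sub_eq_zero]
  refine Finset.sum_subset (Finset.range_subset_range.mpr hd) fun n _ hn => ?_
  have hn' : d < n := by
    rw [Finset.mem_range] at hn
    omega
  exact psiTerm_orderGE hF hD n 0 f (orderGE_zero_left f) d (by omega)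

theorem OpOrderGE.psi (hD : OpOrderGE r D) (hF : OrderGE 3 F) : OpOrderGE r (psi F D) := by
  intro n f hf d hd
  rw [comp_psi]
  exact Finset.sum_eq_zero fun k _ => psiTerm_orderGE hF hD k n f hf d (by omega)

/-- `ψ_F` as a linear map. -/
def psiLin (F : Series 𝕜 I₀ I₁) : Module.End 𝕜 (Module.End 𝕜 (Series 𝕜 I₀ I₁)) where
  toFun := psi F
  map_add' D E := LinearMap.ext fun f => series_ext fun d => by
    rw [LinearMap.add_apply, comp_add]
    simp only [comp_psi, psiTerm, ← adLin_pow_apply, map_add, smul_add, LinearMap.add_apply,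
      comp_add, Finset.sum_add_distrib]
  map_smul' c D := LinearMap.ext fun f => series_ext fun d => by
    rw [LinearMap.smul_apply, comp_smul]
    simp only [comp_psi, psiTerm, ← adLin_pow_apply, map_smul, LinearMap.smul_apply, comp_smul,
      Finset.smul_sum, RingHom.id_apply]
    exact Finset.sum_congr rfl fun n _ => smul_comm _ _ _

theorem psiLin_apply (F : Series 𝕜 I₀ I₁) (D : Module.End 𝕜 (Series 𝕜 I₀ I₁)) :
    psiLin F D = psi F D := rfl

theorem OpHasParity.psi {p : ZMod 2} (hD : OpHasParity p D) (hF : HasParity 0 F) :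
    OpHasParity p (psi F D) := by
  have h (n : ℕ) : OpHasParity p ((SuperAiry.adOp F)^[n] D) := by
    induction n with
    | zero => exact hD
    | succ n ih =>
      rw [Function.iterate_succ_apply']
      exact ih.adOp hF
  intro q f hf d
  rw [comp_psi, map_sum, Finset.smul_sum]
  refine Finset.sum_congr rfl fun n _ => ?_
  rw [psiTerm, LinearMap.smul_apply, comp_smul, map_smul, h n q f hf d, smul_comm]

/-- `ψ_F(ħ) = ħ`. -/
theorem psi_hbarOp (F f : Series 𝕜 I₀ I₁) : psi F hbarOp f = hbarOp f := by
  have h0 : adOp F hbarOp = 0 := by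
    refine adOp_eq_of_hbarOp_mul ?_
    rw [mul_zero]
    refine LinearMap.ext fun f => ?_
    change 0 = hbarOp (F * f) - F * hbarOp f
    rw [hbarOp_mul_comm, sub_self]
  have h (n : ℕ) : psiTerm F hbarOp (n + 1) = 0 := by
    rw [psiTerm, Function.iterate_succ_apply, h0, ← adLin_pow_apply, map_zero, smul_zero]
  refine series_ext fun d => ?_
  rw [comp_psi, Finset.sum_range_succ', psiTerm_zero, Finset.sum_eq_zero, zero_add]
  intro n _
  rw [h, LinearMap.zero_apply, comp_zero]

theorem adOp_add_left (F H : Series 𝕜 I₀ I₁) (D : Module.End 𝕜 (Series 𝕜 I₀ I₁)) :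
    adOp (F + H) D = adOp F D + adOp H D := by
  ext1 f
  rw [LinearMap.add_apply, adOp_apply, adOp_apply, adOp_apply, ← map_neg, ← map_neg, ← map_neg,
    ← map_add, add_mul, add_mul, map_add]
  congr 1
  abel

/-- The terms of `ψ_{F+H}(D)` and `ψ_F(D)` beyond the first agree up to an order that
increases. -/
theorem adOp_iterate_add_sub_orderGE (hF : OrderGE 3 F) (hH : OrderGE (m + 3) H)
    (hD : OpOrderGE r D) (n : ℕ) :
    OpOrderGE (r + n + (m + 1)) ((adOp (F + H))^[n + 1] D - (adOp F)^[n + 1] D) := by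
  induction n with
  | zero =>
    have h : adOp (F + H) D - adOp F D = adOp H D := by rw [adOp_add_left, add_sub_cancel_left]
    change OpOrderGE (r + (m + 1)) (adOp (F + H) D - adOp F D)
    rw [h]
    exact hD.adOp hH
  | succ n ih =>
    have h : (adOp (F + H))^[n + 1 + 1] D - (adOp F)^[n + 1 + 1] D =
        adOp (F + H) ((adOp (F + H))^[n + 1] D - (adOp F)^[n + 1] D) +
          adOp H ((adOp F)^[n + 1] D) := by
      rw [Function.iterate_succ_apply' _ (n + 1), Function.iterate_succ_apply' _ (n + 1)]
      change _ = adLin (F + H) _ + _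
      rw [map_sub]
      change _ = adOp (F + H) _ - adOp (F + H) _ + _
      rw [adOp_add_left F H ((adOp F)^[n + 1] D)]
      abel
    rw [h]
    have hFH : OrderGE (1 + 2) (F + H) := hF.add (hH.mono (by omega))
    exact ((ih.adOp hFH).mono (by omega)).add (((hD.adOp_iterate hF (n + 1)).adOp hH).mono
      (by omega))

/-- To first order in `H`, the change of `ψ_F(D)` when `F` is replaced with `F + H` is
`-(1/ħ)[H, D]`. -/
theorem psi_add_sub_orderGE (hF : OrderGE 3 F) (hH : OrderGE (m + 3) H) (hD : OpOrderGE r D)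
    (f : Series 𝕜 I₀ I₁) :
    OrderGE (r + m + 2) (psi (F + H) D f - psi F D f - adOp H D f) := by
  intro d hd
  rw [comp_sub, comp_sub, comp_psi, comp_psi, ← Finset.sum_sub_distrib, sub_eq_zero,
    Finset.sum_range_succ']
  rw [psiTerm_zero, psiTerm_zero, sub_self, add_zero]
  have h (n : ℕ) : comp d (psiTerm (F + H) D (n + 1) f) - comp d (psiTerm F D (n + 1) f) =
      ((n + 1).factorial : 𝕜)⁻¹ •
        comp d (((adOp (F + H))^[n + 1] D - (adOp F)^[n + 1] D) f) := by
    rw [psiTerm, psiTerm, LinearMap.smul_apply, LinearMap.smul_apply, comp_smul, comp_smul,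
      ← smul_sub, LinearMap.sub_apply, comp_sub]
  have h1 : adOp (F + H) D - adOp F D = adOp H D := by rw [adOp_add_left, add_sub_cancel_left]
  rcases d with _ | d
  · exact (hD.adOp hH 0 f (orderGE_zero_left f) 0 (by omega)).symm
  · rw [Finset.sum_range_succ', Finset.sum_eq_zero, zero_add, h]
    · simp [h1]
    · intro n _
      rw [h, adOp_iterate_add_sub_orderGE hF hH hD (n + 1) 0 f (orderGE_zero_left f) _ (by omega),
        smul_zero]

/-- A family of operators stays continuous in the pointwise topologies under `ψ_F`. -/
theorem psi_continuous {V : Type*} [AddCommGroup V] [Module 𝕜 V]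
    (F : Series 𝕜 I₀ I₁) (T : Module.Dual 𝕜 V → Module.End 𝕜 (Series 𝕜 I₀ I₁))
    (hT : ∀ (f : Series 𝕜 I₀ I₁) (n : ℕ), ∃ s : Finset V, ∀ φ : Module.Dual 𝕜 V,
      (∀ v ∈ s, φ v = 0) → OrderGE n (T φ f)) (f : Series 𝕜 I₀ I₁) (n : ℕ) :
    ∃ s : Finset V, ∀ φ : Module.Dual 𝕜 V, (∀ v ∈ s, φ v = 0) → OrderGE n (psi F (T φ) f) := by
  classical
  have h (k : ℕ) : ∀ (f : Series 𝕜 I₀ I₁) (n : ℕ), ∃ s : Finset V, ∀ φ : Module.Dual 𝕜 V,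
      (∀ v ∈ s, φ v = 0) → OrderGE n ((adOp F)^[k] (T φ) f) := by
    induction k with
    | zero => exact hT
    | succ k ih =>
      intro f n
      obtain ⟨s, hs⟩ := ih f (n + 2)
      obtain ⟨t, ht⟩ := ih (F * f) (n + 2)
      refine ⟨s ∪ t, fun φ hφ => ?_⟩
      rw [Function.iterate_succ_apply', adOp_apply]
      exact ((mulOp_orderGE 0 F (orderGE_zero_left F) _ _
        (hs φ fun v hv => hφ v (Finset.mem_union_left _ hv))).sub
        (ht φ fun v hv => hφ v (Finset.mem_union_right _ hv))).divHbarOp.neg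
  choose s hs using h
  refine ⟨(Finset.range n).biUnion fun k => s k f n, fun φ hφ d hd => ?_⟩
  rw [comp_psi]
  refine Finset.sum_eq_zero fun k hk => ?_
  refine (hs k f n φ fun v hv => hφ v ?_).smul _ d hd
  exact Finset.mem_biUnion.mpr ⟨k, Finset.mem_range.mpr (by rw [Finset.mem_range] at hk; omega), hv⟩

section CharZero

variable [CharZero 𝕜]

theorem adOp_psiTerm (F : Series 𝕜 I₀ I₁) (D : Module.End 𝕜 (Series 𝕜 I₀ I₁)) (n : ℕ) :
    adOp F (psiTerm F D n) = ((n + 1 : ℕ) : 𝕜) • psiTerm F D (n + 1) := by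
  have h1 : ((n + 1 : ℕ) : 𝕜) ≠ 0 := Nat.cast_ne_zero.mpr n.succ_ne_zero
  change adLin F _ = _
  rw [psiTerm, psiTerm, map_smul, Function.iterate_succ_apply', smul_smul, Nat.factorial_succ,
    Nat.cast_mul, mul_inv, ← mul_assoc, mul_inv_cancel₀ h1, one_mul]
  rfl

/-- The Leibniz formula for the terms of `ψ_F` on a product. -/
theorem psiTerm_mul (hF : HasParity 0 F) (hT : T ∈ Weyl 𝕜 I₀ I₁) (hU : U ∈ Weyl 𝕜 I₀ I₁) (n : ℕ) :
    psiTerm F (T * U) n =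
      ∑ x ∈ Finset.HasAntidiagonal.antidiagonal n, psiTerm F T x.1 * psiTerm F U x.2 := by
  induction n with
  | zero => simp [psiTerm_zero]
  | succ n ih =>
    have hmem {S : Module.End 𝕜 (Series 𝕜 I₀ I₁)} (hS : S ∈ Weyl 𝕜 I₀ I₁) (k : ℕ) :
        psiTerm F S k ∈ Weyl 𝕜 I₀ I₁ := Subalgebra.smul_mem _ (adOp_iterate_mem hF hS k) _
    have h1 : ((n + 1 : ℕ) : 𝕜) ≠ 0 := Nat.cast_ne_zero.mpr n.succ_ne_zero
    -- Multiplied by `n + 1`, the identity is the Leibniz rule applied to the previous one, as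
    -- `(n + 1) = i + j` splits into the factors of `adOp_psiTerm` for `T` and for `U`.
    have h2 : ((n + 1 : ℕ) : 𝕜) • psiTerm F (T * U) (n + 1) = ((n + 1 : ℕ) : 𝕜) •
        ∑ x ∈ Finset.HasAntidiagonal.antidiagonal (n + 1),
          psiTerm F T x.1 * psiTerm F U x.2 := by
      have hl : ∑ x ∈ Finset.HasAntidiagonal.antidiagonal (n + 1),
          (x.1 : 𝕜) • (psiTerm F T x.1 * psiTerm F U x.2) =
          ∑ x ∈ Finset.HasAntidiagonal.antidiagonal n,
            ((x.1 + 1 : ℕ) : 𝕜) • (psiTerm F T (x.1 + 1) * psiTerm F U x.2) := by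
        rw [Finset.Nat.sum_antidiagonal_succ, Nat.cast_zero, zero_smul, zero_add]
      have hr : ∑ x ∈ Finset.HasAntidiagonal.antidiagonal (n + 1),
          (x.2 : 𝕜) • (psiTerm F T x.1 * psiTerm F U x.2) =
          ∑ x ∈ Finset.HasAntidiagonal.antidiagonal n,
            ((x.2 + 1 : ℕ) : 𝕜) • (psiTerm F T x.1 * psiTerm F U (x.2 + 1)) := by
        rw [Finset.Nat.sum_antidiagonal_succ', Nat.cast_zero, zero_smul]
        exact zero_add _
      have hs : ((n + 1 : ℕ) : 𝕜) • ∑ x ∈ Finset.HasAntidiagonal.antidiagonal (n + 1),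
          psiTerm F T x.1 * psiTerm F U x.2 =
          ∑ x ∈ Finset.HasAntidiagonal.antidiagonal (n + 1),
            (x.1 : 𝕜) • (psiTerm F T x.1 * psiTerm F U x.2) +
          ∑ x ∈ Finset.HasAntidiagonal.antidiagonal (n + 1),
            (x.2 : 𝕜) • (psiTerm F T x.1 * psiTerm F U x.2) := by
        rw [Finset.smul_sum, ← Finset.sum_add_distrib]
        refine Finset.sum_congr rfl fun x hx => ?_
        rw [← add_smul, ← Nat.cast_add, Finset.HasAntidiagonal.mem_antidiagonal.mp hx]
      rw [hs, hl, hr, ← adOp_psiTerm, ih]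
      change adLin F _ = _
      rw [map_sum, ← Finset.sum_add_distrib]
      refine Finset.sum_congr rfl fun x _ => ?_
      change adOp F _ = _
      rw [adOp_mul hF (hmem hT _) (hmem hU _), adOp_psiTerm, adOp_psiTerm, smul_mul_assoc,
        mul_smul_comm]
    rw [← inv_smul_smul₀ h1 (psiTerm F (T * U) (n + 1)), h2, inv_smul_smul₀ h1]

/-- `ψ_F` is multiplicative on the completed Weyl algebra. -/
theorem psi_mul (hF : HasParity 0 F) (hF3 : OrderGE 3 F) (hT : T ∈ Weyl 𝕜 I₀ I₁)
    (hU : U ∈ Weyl 𝕜 I₀ I₁) (f : Series 𝕜 I₀ I₁) :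
    psi F (T * U) f = psi F T (psi F U f) := by
  refine series_ext fun d => ?_
  have hTo := weyl_orderGE hT
  have hUo := weyl_orderGE hU
  have h1 (i : ℕ) : comp d (psiTerm F T i (psi F U f)) =
      ∑ j ∈ Finset.range (d + 1), comp d (psiTerm F T i (psiTerm F U j f)) := by
    have h2 := psiTerm_orderGE hF3 hTo i _ _ (psi_sub_sum_orderGE hF3 hUo f (d + 1)) d (by omega)
    rw [map_sub, comp_sub, map_sum, comp_sum] at h2
    exact sub_eq_zero.mp h2
  have h0 (i j : ℕ) (hij : d < i + j) : comp d (psiTerm F T i (psiTerm F U j f)) = 0 :=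
    psiTerm_orderGE hF3 hTo i _ _ (psiTerm_orderGE hF3 hUo j 0 f (orderGE_zero_left f)) d
      (by omega)
  rw [comp_psi, comp_psi]
  simp only [h1, psiTerm_mul hF hT hU, LinearMap.sum_apply, comp_sum, Module.End.mul_apply]
  simp only [Finset.Nat.sum_antidiagonal_eq_sum_range_succ_mk]
  rw [Finset.sum_range_diag_flip (d + 1)
    fun i j => comp d (psiTerm F T i (psiTerm F U j f))]
  refine Finset.sum_congr rfl fun i _ => ?_
  refine Finset.sum_subset (Finset.range_subset_range.mpr (Nat.sub_le _ _)) fun j _ hj => ?_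
  rw [Finset.mem_range] at hj
  exact h0 i j (by omega)

end CharZero

end Psi

/-! ### Free energies of super quantum Airy structures -/

section FreeEnergy

/-- `ψ_F(D)` and `D` have the same component of lowest degree. -/
theorem psi_sub_orderGE {𝕜 : Type*} [Field 𝕜] {I₀ I₁ : Type*} {r : ℕ} {F : Series 𝕜 I₀ I₁}
    {D : Module.End 𝕜 (Series 𝕜 I₀ I₁)} (hF : OrderGE 3 F) (hD : OpOrderGE r D) :
    OpOrderGE (r + 1) (psi F D - D) := by
  intro n f hf d hd
  rw [LinearMap.sub_apply, comp_sub, comp_psi, Finset.sum_range_succ', psiTerm_zero,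
    add_sub_cancel_right]
  exact Finset.sum_eq_zero fun k _ => psiTerm_orderGE hF hD (k + 1) n f hf d (by omega)

variable {𝕜 : Type*} [Field 𝕜] {I₀ I₁ : Type*} {V : Type*} [AddCommGroup V] [Module 𝕜 V]
  {𝒱 : ZMod 2 → Submodule 𝕜 V} {b : Module.Basis (I₀ ⊕ I₁) 𝕜 V}
  {L : Module.Dual 𝕜 V →ₗ[𝕜] Weyl 𝕜 I₀ I₁} {F H : Series 𝕜 I₀ I₁} {m n : ℕ}

/-- The coordinate functionals are homogeneous. -/
theorem coord_eq_zero [DirectSum.Decomposition 𝒱] (hb₀ : ∀ i, b (Sum.inl i) ∈ 𝒱 0)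
    (hb₁ : ∀ j, b (Sum.inr j) ∈ 𝒱 1) (i : I₀ ⊕ I₁) (v : V) (hv : v ∈ 𝒱 (par (incl i) + 1)) :
    b.coord i v = 0 := by
  classical
  have hb (k : I₀ ⊕ I₁) : b k ∈ 𝒱 (par (incl k)) := by
    rcases k with k | k
    · exact hb₀ k
    · exact hb₁ k
  set p := par (incl i)
  -- The projection of `V` to the span of the basis vectors of the parity of `b i`.
  let P : V →ₗ[𝕜] V := b.constr 𝕜 fun k => if par (incl k) = p then b k else 0
  have hPb (k) : P (b k) = if par (incl k) = p then b k else 0 := b.constr_basis 𝕜 _ k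
  have hP (w : V) : P w ∈ 𝒱 p := by
    have h : ⊤ ≤ (𝒱 p).comap P := by
      rw [← b.span_eq, Submodule.span_le]
      rintro _ ⟨k, rfl⟩
      change P (b k) ∈ 𝒱 p
      rw [hPb]
      split_ifs with hk
      · exact hk ▸ hb k
      · exact zero_mem _
    exact h trivial
  have hQ (w : V) : w - P w ∈ 𝒱 (p + 1) := by
    have h : ⊤ ≤ (𝒱 (p + 1)).comap (LinearMap.id - P) := by
      rw [← b.span_eq, Submodule.span_le]
      rintro _ ⟨k, rfl⟩
      change b k - P (b k) ∈ 𝒱 (p + 1)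
      rw [hPb]
      split_ifs with hk
      · rw [sub_self]; exact zero_mem _
      · have h1 : par (incl k) = p + 1 := by
          rcases zmod_two_cases (par (incl k)) with h2 | h2 <;>
            rcases zmod_two_cases p with h3 | h3
          · exact absurd (h2.trans h3.symm) hk
          · rw [h2, h3]; rfl
          · rw [h2, h3]; rfl
          · exact absurd (h2.trans h3.symm) hk
        rw [sub_zero, ← h1]
        exact hb k
    exact h trivial
  have hPv : P v = 0 := by
    have h1 : P v ∈ 𝒱 (p + 1) := by
      have := sub_mem hv (hQ v)
      rwa [sub_sub_cancel] at this
    refine Submodule.disjoint_def.mp ((DirectSum.Decomposition.isInternal 𝒱).submodule_iSupIndep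
      |>.pairwiseDisjoint ?_) _ (hP v) h1
    simp
  have hc : b.coord i ∘ₗ P = b.coord i := by
    refine b.ext fun k => ?_
    change b.coord i (P (b k)) = b.coord i (b k)
    rw [hPb]
    split_ifs with hk
    · rfl
    · have hki : k ≠ i := by
        rintro rfl
        exact hk rfl
      simp [hki]
  rw [← hc, LinearMap.comp_apply, hPv, map_zero]

theorem opHasParity_coord [DirectSum.Decomposition 𝒱] (hb₀ : ∀ i, b (Sum.inl i) ∈ 𝒱 0)
    (hb₁ : ∀ j, b (Sum.inr j) ∈ 𝒱 1) (hL : IsSuperQuantumAiryStructure 𝒱 b L) (i : I₀ ⊕ I₁) :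
    OpHasParity (par (incl i)) (L (b.coord i)).1 :=
  hL.even _ _ (coord_eq_zero hb₀ hb₁ i)

theorem coord_orderGE (hL : IsSuperQuantumAiryStructure 𝒱 b L) (i : I₀ ⊕ I₁) :
    OpOrderGE 1 (L (b.coord i)).1 := by
  have h := ((hL.leading i).mono one_le_two).add (hbarOp_pdOp_orderGE (𝕜 := 𝕜) (incl i))
  rwa [sub_add_cancel] at h

theorem pdOp_one (a : I₀ ⊕ Option I₁) : pdOp a (1 : Series 𝕜 I₀ I₁) = 0 :=
  series_ext fun d => by
    rw [comp_pdOp, comp_one, if_neg d.succ_ne_zero, map_zero, comp_zero]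

/-- The linearization of `F ↦ ψ_F(L(yᵢ)) · 1` is `∂ᵢ` in lowest order. -/
theorem psi_add_coord_orderGE (hL : IsSuperQuantumAiryStructure 𝒱 b L) (hF : OrderGE 3 F)
    (hH : OrderGE (m + 3) H) (i : I₀ ⊕ I₁) :
    OrderGE (m + 3) (psi (F + H) (L (b.coord i)).1 1 - psi F (L (b.coord i)).1 1 -
      pdOp (incl i) H) := by
  have h1 := (psi_add_sub_orderGE hF hH (coord_orderGE hL i) 1).mono (show m + 3 ≤ 1 + m + 2 by
    omega)
  have h2 := ((hL.leading i).adOp hH 0 1 (orderGE_zero_left 1)).mono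
    (show m + 3 ≤ 0 + (2 + (m + 1)) by omega)
  have h3 : adOp H (hbarOp * pdOp (incl i)) 1 = pdOp (incl i) H := by
    rw [adOp_apply, Module.End.mul_apply, Module.End.mul_apply, pdOp_one, map_zero, mul_zero,
      mul_one, zero_sub, map_neg, neg_neg, divHbarOp_hbarOp]
  have h4 : adOp H ((L (b.coord i)).1 - hbarOp * pdOp (incl i)) 1 =
      adOp H (L (b.coord i)).1 1 - pdOp (incl i) H := by
    rw [← h3]
    change adLin H _ 1 = _
    rw [map_sub]
    rfl
  rw [h4] at h2
  rw [← sub_add_sub_cancel _ (adOp H (L (b.coord i)).1 1)]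
  exact h1.add h2

/-- By continuity it suffices to test the coordinate functionals. -/
theorem psi_orderGE_of_coord (hL : IsSuperQuantumAiryStructure 𝒱 b L)
    (h : ∀ i, OrderGE n (psi F (L (b.coord i)).1 1)) (φ : Module.Dual 𝕜 V) :
    OrderGE n (psi F (L φ).1 1) := by
  classical
  obtain ⟨s, hs⟩ := psi_continuous F (fun φ => (L φ).1) hL.continuous 1 n
  -- `φ` agrees on `s` with a combination of finitely many coordinate functionals.
  set T : Finset (I₀ ⊕ I₁) := s.biUnion fun v => (b.repr v).support
  set φ' : Module.Dual 𝕜 V := ∑ k ∈ T, φ (b k) • b.coord k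
  have h1 : OrderGE n (psi F (L (φ - φ')).1 1) := by
    refine hs _ fun v hv => ?_
    have hv' : φ v = ∑ k ∈ T, φ (b k) * b.repr v k := by
      conv_lhs => rw [← b.linearCombination_repr v]
      rw [Finsupp.linearCombination_apply, Finsupp.sum_of_support_subset (s := T), map_sum]
      · exact Finset.sum_congr rfl fun k _ => by rw [map_smul, smul_eq_mul, mul_comm]
      · exact Finset.subset_biUnion_of_mem (fun v => (b.repr v).support) hv
      · simp
    rw [LinearMap.sub_apply, hv', LinearMap.sum_apply, sub_eq_zero]
    rfl
  have h2 : OrderGE n (psi F (L φ').1 1) := by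
    have h3 : psi F (L φ').1 1 = ∑ k ∈ T, φ (b k) • psi F (L (b.coord k)).1 1 := by
      simp only [← psiLin_apply, φ', map_sum, map_smul, AddSubmonoidClass.coe_finsetSum,
        Subalgebra.coe_smul, LinearMap.sum_apply, LinearMap.smul_apply]
    rw [h3]
    exact OrderGE.sum fun k _ => (h k).smul _
  have h4 : psi F (L φ).1 1 = psi F (L (φ - φ')).1 1 + psi F (L φ').1 1 := by
    rw [← LinearMap.add_apply, ← psiLin_apply, ← psiLin_apply, ← psiLin_apply, ← map_add, map_sub,
      Subalgebra.coe_sub, sub_add_cancel]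
  rw [h4]
  exact h1.add h2

/-- In lowest degree `ψ_F(L(yᵢ))` acts as `ħ∂ᵢ`. -/
theorem comp_psi_coord (hL : IsSuperQuantumAiryStructure 𝒱 b L) (hF3 : OrderGE 3 F)
    (i : I₀ ⊕ I₁) {g : Series 𝕜 I₀ I₁} (hg : OrderGE (m + 2) g) :
    comp (m + 3) (psi F (L (b.coord i)).1 g) =
      hbar 𝕜 I₀ I₁ * pd 𝕜 I₀ I₁ (incl i) (comp (m + 2) g) := by
  have h1 := psi_sub_orderGE hF3 (coord_orderGE hL i) _ g hg (m + 3) (by omega)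
  have h2 := hL.leading i _ g hg (m + 3) (by omega)
  rw [LinearMap.sub_apply, comp_sub] at h1 h2
  rw [sub_eq_zero.mp h1, sub_eq_zero.mp h2, Module.End.mul_apply, comp_hbarOp, comp_pdOp]

/-- `F` solves the equations of a free energy up to terms of order at least `n`. -/
structure IsPartialFreeEnergy (L : Module.Dual 𝕜 V →ₗ[𝕜] Weyl 𝕜 I₀ I₁) (n : ℕ)
    (F : Series 𝕜 I₀ I₁) : Prop where
  even : HasParity 0 F
  order : OrderGE 3 F
  no_constant : ∀ d, comp d F ∈ Ideal.span (Set.range (gen 𝕜 I₀ I₁))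
  annihilates : ∀ φ : Module.Dual 𝕜 V, OrderGE n (psi F (L φ).1 1)

theorem isPartialFreeEnergy_zero (hL : IsSuperQuantumAiryStructure 𝒱 b L) :
    IsPartialFreeEnergy L 2 (0 : Series 𝕜 I₀ I₁) where
  even d := by simp
  order := orderGE_zero_right 3
  no_constant d := zero_mem _
  annihilates := psi_orderGE_of_coord hL fun i => by
    have h1 := psi_sub_orderGE (orderGE_zero_right 3) (coord_orderGE hL i) 0 1
      (orderGE_zero_left 1)
    have h2 := hL.leading i 0 1 (orderGE_zero_left 1)
    rw [LinearMap.sub_apply, Module.End.mul_apply, pdOp_one, map_zero, sub_zero] at h2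
    rw [LinearMap.sub_apply] at h1
    rw [← sub_add_cancel (psi 0 (L (b.coord i)).1 1) ((L (b.coord i)).1 1)]
    exact h1.add h2

variable [CharZero 𝕜]

/-- The lowest order of `ψ_F(L(φ)) · 1` bounds that of `ψ_F(G) · 1` for all `G` in the left ideal
generated by the image of `L`. -/
theorem psi_ideal_orderGE (hF : HasParity 0 F) (hF3 : OrderGE 3 F)
    (h : ∀ φ, OrderGE n (psi F (L φ).1 1)) {G : Weyl 𝕜 I₀ I₁}
    (hG : G ∈ Ideal.span (Set.range L)) : OrderGE n (psi F G.1 1) := by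
  induction hG using Submodule.span_induction with
  | mem x hx =>
    obtain ⟨φ, rfl⟩ := hx
    exact h φ
  | zero =>
    rw [← psiLin_apply, Subalgebra.coe_zero, map_zero]
    exact orderGE_zero_right n
  | add x y _ _ hx hy =>
    rw [← psiLin_apply, Subalgebra.coe_add, map_add]
    exact hx.add hy
  | smul T x _ hx =>
    rw [smul_eq_mul, Subalgebra.coe_mul, psi_mul hF hF3 T.2 x.2]
    exact (weyl_orderGE T.2).psi hF3 n _ hx

/-- The obstructions `uᵢ = (ψ_F(L(yᵢ)) · 1)_{m+2}` to extending a partial solution form a closed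
form: apply `ψ_F([L(yᵢ), L(yⱼ)]) ∈ ħ ψ_F(𝔏)` to `1` and take the lowest component. -/
theorem pd_obstruction [DirectSum.Decomposition 𝒱] (hb₀ : ∀ i, b (Sum.inl i) ∈ 𝒱 0)
    (hb₁ : ∀ j, b (Sum.inr j) ∈ 𝒱 1) (hL : IsSuperQuantumAiryStructure 𝒱 b L)
    (hF : HasParity 0 F) (hF3 : OrderGE 3 F) (h : ∀ φ, OrderGE (m + 2) (psi F (L φ).1 1))
    (i j : I₀ ⊕ I₁) :
    pd 𝕜 I₀ I₁ (incl i) (comp (m + 2) (psi F (L (b.coord j)).1 1)) =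
      swapSign 𝕜 (incl i) (incl j) •
        pd 𝕜 I₀ I₁ (incl j) (comp (m + 2) (psi F (L (b.coord i)).1 1)) := by
  obtain ⟨G, hG, hGe⟩ := hL.involutive (par (incl i)) (par (incl j)) _
    (Ideal.subset_span ⟨b.coord i, rfl⟩) _ (Ideal.subset_span ⟨b.coord j, rfl⟩)
    (opHasParity_coord hb₀ hb₁ hL i) (opHasParity_coord hb₀ hb₁ hL j)
  change _ - swapSign 𝕜 (incl i) (incl j) • _ = _ at hGe
  have h1 : psi F (L (b.coord i)).1 (psi F (L (b.coord j)).1 1) -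
      swapSign 𝕜 (incl i) (incl j) • psi F (L (b.coord j)).1 (psi F (L (b.coord i)).1 1) =
      hbarOp (psi F G.1 1) := by
    have h2 := congrArg (fun T : Weyl 𝕜 I₀ I₁ => psiLin F T.1 1) hGe
    simp only [Subalgebra.coe_sub, Subalgebra.coe_smul, Subalgebra.coe_mul, map_sub, map_smul,
      LinearMap.sub_apply, LinearMap.smul_apply, psiLin_apply] at h2
    rwa [psi_mul hF hF3 (L _).2 (L _).2, psi_mul hF hF3 (L _).2 (L _).2,
      psi_mul hF hF3 hbarWeyl.2 G.2, show (hbarWeyl : Weyl 𝕜 I₀ I₁).1 = hbarOp from rfl,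
      psi_hbarOp] at h2
  have h3 := congrArg (comp (m + 3)) h1
  rw [(psi_ideal_orderGE hF hF3 h hG).hbarOp (m + 3) (by omega), comp_sub, comp_smul,
    comp_psi_coord hL hF3 i (h _), comp_psi_coord hL hF3 j (h _), ← mul_smul_comm, ← mul_sub] at h3
  have h4 := congrArg (divHbar 𝕜 I₀ I₁) h3
  rw [divHbar_hbar_mul, map_zero] at h4
  exact sub_eq_zero.mp h4

/-- A partial free energy is improved by one degree, by adding a homogeneous primitive of the
obstruction. -/
theorem IsPartialFreeEnergy.exists_step [DirectSum.Decomposition 𝒱]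
    (hb₀ : ∀ i, b (Sum.inl i) ∈ 𝒱 0) (hb₁ : ∀ j, b (Sum.inr j) ∈ 𝒱 1)
    (hL : IsSuperQuantumAiryStructure 𝒱 b L) (hF : IsPartialFreeEnergy L (m + 2) F) :
    ∃ F', IsPartialFreeEnergy L (m + 3) F' ∧ OrderGE (m + 3) (F' - F) := by
  classical
  set w : I₀ ⊕ I₁ → Poly 𝕜 I₀ I₁ := fun i => -comp (m + 2) (psi F (L (b.coord i)).1 1)
  -- The obstruction, extended by zero in the direction of the additional variable `x⁰`.
  set u : I₀ ⊕ Option I₁ → Poly 𝕜 I₀ I₁ :=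
    Sum.elim (fun i => w (Sum.inl i)) fun o => o.elim 0 fun j => w (Sum.inr j)
  have hu (i : I₀ ⊕ I₁) : u (incl i) = w i := by rcases i with i | j <;> rfl
  have hrange (a) : a = Sum.inr none ∨ a ∈ Set.range (incl : I₀ ⊕ I₁ → I₀ ⊕ Option I₁) := by
    rcases a with i | _ | j
    · exact Or.inr ⟨Sum.inl i, rfl⟩
    · exact Or.inl rfl
    · exact Or.inr ⟨Sum.inr j, rfl⟩
  have hmem (i : I₀ ⊕ I₁) : w i ∈ homog 𝕜 I₀ I₁ (m + 2) := neg_mem (comp_mem _ _)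
  have hfin : {i | w i ≠ 0}.Finite := by
    obtain ⟨s, hs⟩ := psi_continuous F (fun φ => (L φ).1) hL.continuous 1 (m + 3)
    refine (s.biUnion fun v => (b.repr v).support).finite_toSet.subset fun i hi => ?_
    by_contra hi'
    refine hi (neg_eq_zero.mpr (hs (b.coord i) (fun v hv => ?_) (m + 2) (by omega)))
    by_contra hne
    exact hi' (Finset.mem_biUnion.mpr ⟨v, hv, Finsupp.mem_support_iff.mpr hne⟩)
  obtain ⟨g, hg, hgpar, hgid, hgpd⟩ := exists_primitive
    (I := Set.range (incl : I₀ ⊕ I₁ → I₀ ⊕ Option I₁)) (d := m + 2) u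
    (by
      refine (hfin.image incl).subset fun a ha => ?_
      rcases hrange a with rfl | ⟨i, rfl⟩
      · exact absurd rfl ha
      · exact ⟨i, by rwa [Set.mem_ofPred_eq, ← hu], rfl⟩)
    (fun a ha => (hrange a).resolve_left (by rintro rfl; exact ha rfl))
    (fun a => by
      rcases hrange a with rfl | ⟨i, rfl⟩
      · exact zero_mem _
      · rw [hu]; exact hmem i)
    (fun a => by
      rcases hrange a with rfl | ⟨i, rfl⟩
      · change parityInv 𝕜 I₀ I₁ 0 = _ • (0 : Poly 𝕜 I₀ I₁)
        rw [map_zero, smul_zero]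
      · have h1 := (opHasParity_coord hb₀ hb₁ hL i).psi hF.even 0 1 hasParity_one
        rw [add_zero] at h1
        rw [hu]
        change parityInv 𝕜 I₀ I₁ (-_) = _ • -_
        rw [map_neg, hasParity_iff.mp h1, smul_neg])
    (by
      rintro _ ⟨i, rfl⟩ _ ⟨j, rfl⟩
      rw [hu, hu]
      change pd 𝕜 I₀ I₁ _ (-_) = _ • pd 𝕜 I₀ I₁ _ (-_)
      rw [map_neg, map_neg, smul_neg,
        pd_obstruction hb₀ hb₁ hL hF.even hF.order hF.annihilates])
  set H : Series 𝕜 I₀ I₁ := ofHomog (m + 3) g hg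
  have hH : OrderGE (m + 3) H := ofHomog_orderGE _ _ _
  refine ⟨F + H, ⟨hF.even.add fun d => ?_, hF.order.add (hH.mono (by omega)), fun d => ?_,
    psi_orderGE_of_coord hL fun i d hd => ?_⟩, by rwa [add_sub_cancel_left]⟩
  · rw [comp_ofHomog]
    split_ifs <;> simp [hgpar]
  · rw [comp_add, comp_ofHomog]
    refine add_mem (hF.no_constant d) ?_
    split_ifs
    · exact hgid
    · exact zero_mem _
  · have h1 := psi_add_coord_orderGE hL hF.order hH i d hd
    rw [comp_sub, comp_sub, sub_sub, sub_eq_zero] at h1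
    rw [h1]
    rcases Nat.lt_succ_iff_lt_or_eq.mp hd with hd' | rfl
    · rw [hF.annihilates _ d hd', OrderGE.pdOp (incl i) hH d hd', add_zero]
    · have h2 : comp (m + 3) H = g := by rw [comp_ofHomog, if_pos rfl]
      rw [comp_pdOp, h2, hgpd _ ⟨i, rfl⟩, hu]
      exact add_neg_cancel _

theorem exists_isFreeEnergy [DirectSum.Decomposition 𝒱] (hb₀ : ∀ i, b (Sum.inl i) ∈ 𝒱 0)
    (hb₁ : ∀ j, b (Sum.inr j) ∈ 𝒱 1) (hL : IsSuperQuantumAiryStructure 𝒱 b L) :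
    ∃ F, IsFreeEnergy L F := by
  have hstep (m : ℕ) (F : Series 𝕜 I₀ I₁) : ∃ F', IsPartialFreeEnergy L (m + 2) F →
      IsPartialFreeEnergy L (m + 3) F' ∧ OrderGE (m + 3) (F' - F) := by
    by_cases hF : IsPartialFreeEnergy L (m + 2) F
    · obtain ⟨F', hF'⟩ := hF.exists_step hb₀ hb₁ hL
      exact ⟨F', fun _ => hF'⟩
    · exact ⟨0, fun h => absurd h hF⟩
  choose step hstep using hstep
  let S : ℕ → Series 𝕜 I₀ I₁ := fun m => Nat.rec 0 step m
  have hS (m : ℕ) : IsPartialFreeEnergy L (m + 2) (S m) := by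
    induction m with
    | zero => exact isPartialFreeEnergy_zero hL
    | succ m ih => exact (hstep m (S m) ih).1
  have hSS (m k : ℕ) : OrderGE (m + 3) (S (m + k) - S m) := by
    induction k with
    | zero =>
      rw [add_zero, sub_self]
      exact orderGE_zero_right _
    | succ k ih =>
      rw [← sub_add_sub_cancel _ (S (m + k))]
      exact ((hstep (m + k) _ (hS (m + k))).2.mono (by omega)).add ih
  -- The limit of the sequence: its component of degree `d` is final from the `d`-th step on.
  set F : Series 𝕜 I₀ I₁ := ofComp (fun d => comp d (S d)) fun d => comp_mem d _
  have hcomp (d : ℕ) : comp d F = comp d (S d) := comp_ofComp _ _ _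
  have hFS (m : ℕ) : OrderGE (m + 3) (F - S m) := by
    intro d hd
    rw [comp_sub, hcomp]
    rcases le_total d m with h | h
    · obtain ⟨k, rfl⟩ := Nat.exists_eq_add_of_le h
      rw [← neg_sub, ← comp_sub, hSS d k d (by omega), neg_zero]
    · obtain ⟨k, rfl⟩ := Nat.exists_eq_add_of_le h
      rw [← comp_sub]
      exact hSS m k _ hd
  refine ⟨F, fun d => ?_, fun d hd => ?_, fun d => ?_, fun φ => ?_⟩
  · rw [hcomp]
    exact (hS d).even d
  · rw [hcomp]
    exact (hS d).order d hd
  · rw [hcomp]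
    exact (hS d).no_constant d
  · refine eq_of_forall_orderGE fun m => ?_
    rw [sub_zero]
    refine psi_orderGE_of_coord hL (fun i d hd => ?_) φ
    have h1 := psi_add_coord_orderGE hL (hS m).order (hFS m) i d (by omega)
    rw [add_sub_cancel, comp_sub, comp_sub, (hS m).annihilates _ d (by omega), sub_zero,
      OrderGE.pdOp (incl i) (hFS m) d (by omega), sub_zero] at h1
    exact h1

/-- The lowest component of the difference of two free energies has vanishing derivatives `∂ᵢ`. -/
theorem IsFreeEnergy.unique (hL : IsSuperQuantumAiryStructure 𝒱 b L) {F F' : Series 𝕜 I₀ I₁}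
    (hF : IsFreeEnergy L F) (hF' : IsFreeEnergy L F') : F' = F := by
  have key (m : ℕ) : OrderGE (m + 3) (F' - F) := by
    induction m with
    | zero => exact hF'.order.sub hF.order
    | succ m ih =>
      intro d hd
      rcases Nat.lt_succ_iff_lt_or_eq.mp (show d < (m + 3) + 1 by omega) with hd' | rfl
      · exact ih d hd'
      refine eq_zero_of_pd_eq_zero (comp_mem _ _) (by simpa using (hF'.even.sub hF.even) (m + 3))
        (sub_mem (hF'.no_constant _) (hF.no_constant _)) none fun a ha => ?_
      have ha' : ∃ i : I₀ ⊕ I₁, incl i = a := by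
        rcases a with i | _ | j
        · exact ⟨Sum.inl i, rfl⟩
        · exact absurd rfl ha
        · exact ⟨Sum.inr j, rfl⟩
      obtain ⟨i, rfl⟩ := ha'
      have h1 := psi_add_coord_orderGE hL hF.order ih i (m + 2) (by omega)
      rw [add_sub_cancel, hF.annihilates, hF'.annihilates, sub_zero, zero_sub, comp_neg,
        neg_eq_zero, comp_pdOp] at h1
      exact h1
  exact eq_of_forall_orderGE fun n => (key n).mono (by omega)

end FreeEnergy

end SuperAiry

end

theorem mainTheorem1 {𝕜 : Type*} [RCLike 𝕜] {V : Type*} [AddCommGroup V] [Module 𝕜 V]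
    (𝒱 : ZMod 2 → Submodule 𝕜 V) [DirectSum.Decomposition 𝒱] {I₀ I₁ : Type*}
    (b : Module.Basis (I₀ ⊕ I₁) 𝕜 V) (hb₀ : ∀ i, b (Sum.inl i) ∈ 𝒱 0)
    (hb₁ : ∀ j, b (Sum.inr j) ∈ 𝒱 1)
    (L : Module.Dual 𝕜 V →ₗ[𝕜] SuperAiry.Weyl 𝕜 I₀ I₁)
    (hL : SuperAiry.IsSuperQuantumAiryStructure 𝒱 b L) :
    ∃! F : SuperAiry.Series 𝕜 I₀ I₁, SuperAiry.IsFreeEnergy L F := by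
  obtain ⟨F, hF⟩ := SuperAiry.exists_isFreeEnergy hb₀ hb₁ hL
  exact ⟨F, hF, fun F' hF' => hF.unique hL hF'⟩
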